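/- Let $u:\mathbb{R}^2\to\mathbb{R}$ be a $C^\infty$ image and $x_0\in\mathbb{R}^2$. For $\varrho>0$ let $D_\varrho(x_0)$ be the closed Euclidean disc of radius $\varrho$ about $x_0$, and let $\nu_\varrho$ be the distribution of the values of $u$ over the disc, $\nu_\varrho(B)=|\{x\in D_\varrho(x_0): u(x)\in B\}|$. Its density at $z\in\mathbb{R}$ is $$\gamma_\varrho(z)=\limsup_{a,b\to z,\ a<b}\frac{\nu_\varrho([a,b])}{b-a}\in[0,\infty]$$ (where $\nu_\varrho$ has a continuous density, this is that density), and a mode of $u$ over $D_\varrho(x_0)$ is a real number at which $\gamma_\varrho$ attains its maximum over $\mathbb{R}$. Where $\nabla u\ne0$, let $\eta=\nabla u/|\nabla u|$, let $\xi$ be the unit vector orthogonal to $\eta$ (the level-line direction), and let $u_{\eta\eta}$, $u_{\xi\xi}$ be the second derivatives of $u$ in these directions. (i) If $\nabla u(x_0)\neq0$, then for all sufficiently small $\varrho>0$ there is exactly one mode $m_\varrho$ of $u$ over $D_\varrho(x_0)$, and as $\varrho\to0^+$ $$m_\varrho-u(x_0)=\frac{\varrho^2}{2}\bigl(u_{\xi\xi}(x_0)-2u_{\eta\eta}(x_0)\bigr)+\mathcal{O}(\varrho^3),$$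 that is, one step of mode filtering approximates an explicit time step of size $\tau=\varrho^2/2$ of the PDE $u_t=u_{\xi\xi}-2u_{\eta\eta}$. The right-hand side of this PDE and the step size are the limits for $p\to-1^+$ of the right-hand side of $u_t=u_{\xi\xi}+(p-1)u_{\eta\eta}$ at $x_0$ and of the step size $\varrho^2/(2p+4)$, which belong to order-$p$ mean filtering. (ii) If $u$ has a local minimum (local maximum) at $x_0$, then for all sufficiently small $\varrho>0$ a mode of $u$ over $D_\varrho(x_0)$ exists, and every such mode $m$ satisfies $m-u(x_0)\ge0$ ($m-u(x_0)\le0$). -/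

import Mathlib

open Set Filter Topology MeasureTheory
open scoped ContDiff ENNReal

noncomputable section

/-- The image plane, with its Euclidean norm. -/
abbrev Plane : Type := EuclideanSpace ℝ (Fin 2)

/-- The unit vector `η` in the direction of the positive gradient of `u` at `x`
(meaningful where the gradient does not vanish). -/
def gradDir (u : Plane → ℝ) (x : Plane) : Plane :=
  ‖gradient u x‖⁻¹ • gradient u x

/-- The unit vector `ξ` in the direction of the level line of `u` through `x`:
the gradient direction rotated by a right angle. -/
def levelDir (u : Plane → ℝ) (x : Plane) : Plane :=
  !₂[-(gradDir u x 1), gradDir u x 0]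

/-- The second derivative of `u` at `x` in the direction `v`. -/
def secondDirDeriv (u : Plane → ℝ) (x v : Plane) : ℝ :=
  iteratedFDeriv ℝ 2 u x ![v, v]

/-- `u_ηη`. -/
def uEtaEta (u : Plane → ℝ) (x : Plane) : ℝ := secondDirDeriv u x (gradDir u x)

/-- `u_ξξ`. -/
def uXiXi (u : Plane → ℝ) (x : Plane) : ℝ := secondDirDeriv u x (levelDir u x)

/-- Right-hand side of the order-`p` mean PDE `u_t = u_ξξ + (p - 1) u_ηη`. -/
def orderPFlow (p : ℝ) (u : Plane → ℝ) (x : Plane) : ℝ :=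
  uXiXi u x + (p - 1) * uEtaEta u x

/-- Right-hand side of the mode filtering PDE `u_t = u_ξξ - 2 u_ηη`. -/
def modeFlow (u : Plane → ℝ) (x : Plane) : ℝ :=
  uXiXi u x - 2 * uEtaEta u x

/-- One explicit (forward Euler) time step of size `τ` for `u_t = F u`, evaluated at `x`. -/
def explicitStep (F : (Plane → ℝ) → Plane → ℝ) (τ : ℝ) (u : Plane → ℝ) (x : Plane) : ℝ :=
  u x + τ * F u x

/-- The distribution of the values of `u` over the closed disc of radius `ρ` about `x`: the image
under `u` of Lebesgue measure on the disc (not normalised, which is irrelevant for its mode). -/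
def valueDistribution (u : Plane → ℝ) (x : Plane) (ρ : ℝ) : Measure ℝ :=
  (volume.restrict (Metric.closedBall x ρ)).map u

/-- The density of a measure `ν` on the line at the value `z`: the upper limit of
`ν [a, b] / (b - a)` as the nondegenerate interval `[a, b]` shrinks to `z`. If `ν` has a continuous
density, this is the value of that density at `z`; at a jump of a piecewise continuous density it is
the larger of the two one-sided limits; at poles of the density and at atoms it is `∞`. -/
def densityAt (ν : Measure ℝ) (z : ℝ) : ℝ≥0∞ :=
  limsup (fun p : ℝ × ℝ => ν (Icc p.1 p.2) / ENNReal.ofReal (p.2 - p.1))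
    (𝓝[{p : ℝ × ℝ | p.1 < p.2}] (z, z))

/-- `m` is a mode of `ν`: the density of `ν` attains its maximum at `m`. -/
def IsModeOf (ν : Measure ℝ) (m : ℝ) : Prop :=
  ∀ z : ℝ, densityAt ν z ≤ densityAt ν m

/-- `m` is a result of mode filtering `u` at `x` with the disc-shaped window of radius `ρ`. -/
def IsDiscMode (u : Plane → ℝ) (x : Plane) (ρ m : ℝ) : Prop :=
  IsModeOf (valueDistribution u x ρ) m

end

/-! For (i), blow `u` up at `x₀` in the frame `η, ξ`: with `g = |∇u(x₀)|` the function `V(x, y) =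
(u(x₀ + ρ(xη + yξ)) - u(x₀)) / (ρg)` is within `O(ρ)` of `x` on the unit disc, and modes of `u` and
of `V` correspond under the affine map `z ↦ u(x₀) + ρgz` (`isModeOf_affine`,
`valueDistribution_Icc_eq`).

Put `w(x) = √(1 - x²)` and substitute `y = t w(x)`. The disc becomes the strip `|x| < 1`, `|t| ≤ 1`
with area element `w(x) dx dt`, so the distribution of `V` is the integral over `t` of the images of
`w(x) dx` under `ψ_t(x) = V(x, t w(x))`. For `|x| ≤ 1/2` every `ψ_t` is `C³`-close to the identity;
hence the image has, for `|s| < 2/5`, the density `φ_t(s) = w/ψ_t'` taken at `x = ψ_t⁻¹(s)`, which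
inherits strong concavity from `w` (`NearlyLinear.exists_density`). So does the integral `f` of
`φ_t` over `t`. Near the centre `f` is almost 2, while a crude strip estimate bounds the density by
39/20 for `|s| ≥ 3/10` (`densityAt_discDistribution_le`). Thus there is exactly one mode.

To locate it, expand `φ_t'(s) ≈ -(s - ψ_t(0)) - ψ_t''`. With `a = u_ηη` and `d = u_ξξ`, `ψ_t(0) ≈
ρt²d/(2g)` and `ψ_t'' ≈ ρ(a - t²d)/g`. Since `t²` has mean 1/3 on `[-1, 1]`, the averaged slope
vanishes to first order at `s = ρ(d - 2a)/(2g)`. Strong concavity turns a slope error `O(ρ²)` into a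
position error `O(ρ²)`, and undoing the scaling by `ρg` gives the claim with error `O(ρ³)`.

For (ii), the density is upper semicontinuous and vanishes off a compact interval, so a mode exists.
A nonzero measure has nonzero density somewhere, so a mode cannot lie outside a closed set
containing all values of `u` on the disc. -/

/-! ### Upper densities and modes of measures on the line -/

theorem eventually_shrinking_interval {z δ : ℝ} (hδ : 0 < δ) {p : ℝ × ℝ → Prop}
    (h : ∀ a b, z - δ < a → a < b → b < z + δ → p (a, b)) :
    ∀ᶠ q in 𝓝[{q : ℝ × ℝ | q.1 < q.2}] (z, z), p q := by
  have h1 : Ioo (z - δ) (z + δ) ×ˢ Ioo (z - δ) (z + δ) ∈ 𝓝 (z, z) :=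
    prod_mem_nhds (Ioo_mem_nhds (by linarith) (by linarith))
      (Ioo_mem_nhds (by linarith) (by linarith))
  filter_upwards [nhdsWithin_le_nhds h1, self_mem_nhdsWithin] with q hq hq'
  exact h q.1 q.2 hq.1.1 hq' hq.2.2

/-- Without this the upper limit along the filter need not agree with the limit when the latter
exists. -/
instance neBot_shrinking_interval (z : ℝ) :
    NeBot (𝓝[{q : ℝ × ℝ | q.1 < q.2}] (z, z)) := by
  rw [← mem_closure_iff_nhdsWithin_neBot, Metric.mem_closure_iff]
  intro ε hε
  refine ⟨(z, z + ε / 2), by simp [hε], ?_⟩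
  simp [Prod.dist_eq, abs_of_pos hε, hε]

/-- A bound on the quotients over all short intervals near `z` holds on an open neighbourhood of
`(z, z)`, which also contains `(y, y)` for `y` near `z`. -/
theorem upperSemicontinuous_densityAt (ν : Measure ℝ) : UpperSemicontinuous (densityAt ν) := by
  intro z c hc
  obtain ⟨c', h1, h2⟩ := exists_between hc
  have h3 := eventually_lt_of_limsup_lt h1
  rw [eventually_nhdsWithin_iff] at h3
  have t : Tendsto (fun x : ℝ => (x, x)) (𝓝 z) (𝓝 (z, z)) :=
    (continuous_id.prodMk continuous_id).tendsto z
  filter_upwards [t.eventually h3.eventually_nhds] with y hy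
  refine lt_of_le_of_lt (limsup_le_of_le (by isBoundedDefault) ?_) h2
  rw [eventually_nhdsWithin_iff]
  filter_upwards [hy] with q hq hlt
  exact (hq hlt).le

theorem densityAt_le_of_forall_le {ν : Measure ℝ} {z δ : ℝ} (hδ : 0 < δ) {c : ℝ≥0∞}
    (h : ∀ a b, z - δ < a → a < b → b < z + δ → ν (Icc a b) ≤ c * ENNReal.ofReal (b - a)) :
    densityAt ν z ≤ c := by
  refine limsup_le_of_le (by isBoundedDefault) (eventually_shrinking_interval hδ ?_)
  intro a b h1 h2 h3
  exact ENNReal.div_le_of_le_mul (h a b h1 h2 h3)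

theorem densityAt_eq_zero_of_null {ν : Measure ℝ} {z : ℝ} {U : Set ℝ} (hU : U ∈ 𝓝 z)
    (h : ν U = 0) : densityAt ν z = 0 := by
  obtain ⟨δ, hδ, hsub⟩ := Metric.mem_nhds_iff.1 hU
  refine le_antisymm (densityAt_le_of_forall_le hδ fun a b h1 _ h3 => ?_) bot_le
  rw [zero_mul, nonpos_iff_eq_zero]
  refine measure_mono_null (fun x hx => hsub ?_) h
  rw [Metric.mem_ball, Real.dist_eq, abs_lt]
  constructor <;> linarith [hx.1, hx.2]

theorem densityAt_eq_of_approx {ν : Measure ℝ} [IsFiniteMeasure ν] {z F : ℝ}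
    (h : ∀ ε > 0, ∃ δ > 0, ∀ a b, z - δ < a → a < b → b < z + δ →
      |ν.real (Icc a b) - (b - a) * F| ≤ ε * (b - a)) :
    densityAt ν z = ENNReal.ofReal F := by
  have h1 : Tendsto (fun p : ℝ × ℝ => ν.real (Icc p.1 p.2) / (p.2 - p.1))
      (𝓝[{q : ℝ × ℝ | q.1 < q.2}] (z, z)) (𝓝 F) := by
    rw [Metric.tendsto_nhds]
    intro ε hε
    obtain ⟨δ, hδ, H⟩ := h (ε / 2) (by linarith)
    refine eventually_shrinking_interval hδ fun a b ha hab hb => ?_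
    have h2 := H a b ha hab hb
    have h3 : 0 < b - a := by linarith
    have h4 : ν.real (Icc a b) / (b - a) - F = (ν.real (Icc a b) - (b - a) * F) / (b - a) := by
      field_simp
    rw [Real.dist_eq]
    simp only
    rw [h4, abs_div, abs_of_pos h3, div_lt_iff₀ h3]
    nlinarith
  refine Tendsto.limsup_eq ?_
  refine (ENNReal.tendsto_ofReal h1).congr' ?_
  filter_upwards [self_mem_nhdsWithin] with q hq
  rw [ENNReal.ofReal_div_of_pos (sub_pos.2 hq), ofReal_measureReal]

theorem exists_isModeOf {ν : Measure ℝ} {A B : ℝ} (hAB : A ≤ B) (h : ν (Icc A B)ᶜ = 0) :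
    ∃ m ∈ Icc A B, IsModeOf ν m := by
  obtain ⟨m, hm, H⟩ := UpperSemicontinuousOn.exists_isMaxOn (nonempty_Icc.2 hAB) isCompact_Icc
    ((upperSemicontinuous_densityAt ν).upperSemicontinuousOn (Icc A B))
  refine ⟨m, hm, fun z => ?_⟩
  by_cases hz : z ∈ Icc A B
  · exact H hz
  · rw [densityAt_eq_zero_of_null (isClosed_Icc.isOpen_compl.mem_nhds hz) h]
    exact bot_le

/-- Zero density makes the increments of the distribution function `o(b - a)` at every point, so its
derivative vanishes everywhere and it is constant; it is zero to the left of `A`. -/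
theorem measure_eq_zero_of_densityAt_eq_zero {ν : Measure ℝ} [IsFiniteMeasure ν] {A B : ℝ}
    (h : ν (Icc A B)ᶜ = 0) (h0 : ∀ z, densityAt ν z = 0) : ν = 0 := by
  have key : ∀ z, HasDerivAt (fun x => ν.real (Iic x)) 0 z := by
    intro z
    rw [hasDerivAt_iff_isLittleO, Asymptotics.isLittleO_iff]
    intro c hc
    have h1 : densityAt ν z < ENNReal.ofReal c := by rw [h0]; simpa using hc
    have h3 := eventually_lt_of_limsup_lt h1
    have h4 : ∀ a b : ℝ, a < b → ν (Icc a b) / ENNReal.ofReal (b - a) < ENNReal.ofReal c →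
        |ν.real (Iic b) - ν.real (Iic a)| ≤ c * (b - a) := by
      intro a b hab hq
      have hba : 0 < b - a := by linarith
      have h5 : ν.real (Iic b) - ν.real (Iic a) = ν.real (Ioc a b) := by
        rw [← Iic_sdiff_Iic, measureReal_sdiff (Iic_subset_Iic.2 hab.le) measurableSet_Iic]
      rw [h5, abs_of_nonneg measureReal_nonneg]
      refine (measureReal_mono Ioc_subset_Icc_self).trans ?_
      rw [ENNReal.div_lt_iff (by simp [hab]) (by simp), ← ENNReal.ofReal_mul hc.le] at hq
      exact ENNReal.toReal_le_of_le_ofReal (by positivity) hq.le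
    rw [eventually_nhdsWithin_iff] at h3
    have t1 : Tendsto (fun x : ℝ => (z, x)) (𝓝 z) (𝓝 (z, z)) :=
      (Continuous.prodMk_right z).tendsto z
    have t2 : Tendsto (fun x : ℝ => (x, z)) (𝓝 z) (𝓝 (z, z)) :=
      (Continuous.prodMk_left z).tendsto z
    filter_upwards [t1.eventually h3, t2.eventually h3] with x hx1 hx2
    rcases lt_trichotomy x z with hlt | rfl | hlt
    · have := h4 x z hlt (hx2 hlt)
      rw [abs_sub_comm] at this
      simpa [Real.norm_eq_abs, abs_sub_comm x z, abs_of_pos (sub_pos.2 hlt)] using this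
    · simp
    · have := h4 z x hlt (hx1 hlt)
      simpa [Real.norm_eq_abs, abs_of_pos (sub_pos.2 hlt)] using this
  -- The maximum covers the case `B < A`: the point must be at least `B` and is compared with one
  -- below `A`.
  have hc := is_const_of_deriv_eq_zero (fun z => (key z).differentiableAt) (fun z => (key z).deriv)
    (max A B) (A - 1)
  have h5 : ν (Iic (A - 1)) = 0 := measure_mono_null (fun x hx => by
    simp only [mem_Iic] at hx
    simp only [mem_compl_iff, mem_Icc, not_and_or, not_le]
    left; linarith) h
  have h6 : ν (Iic (max A B)) = 0 := by
    simp only [measureReal_def, h5] at hc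
    simpa [ENNReal.toReal_eq_zero_iff] using hc
  rw [← Measure.measure_univ_eq_zero, ← union_compl_self (Iic (max A B))]
  refine measure_union_null h6 (measure_mono_null (fun x hx => ?_) h)
  simp only [mem_compl_iff, mem_Iic, not_le, max_lt_iff] at hx
  simp only [mem_compl_iff, mem_Icc, not_and_or, not_le]
  right; exact hx.2

theorem IsModeOf.densityAt_ne_zero {ν : Measure ℝ} [IsFiniteMeasure ν] {A B m : ℝ}
    (h : ν (Icc A B)ᶜ = 0) (hν : ν ≠ 0) (hm : IsModeOf ν m) : densityAt ν m ≠ 0 :=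
  fun h0 => hν (measure_eq_zero_of_densityAt_eq_zero h fun z => le_antisymm (h0 ▸ hm z) bot_le)

/-- An affine change of the value axis, together with a rescaling of mass, multiplies every density
by the same constant. -/
theorem densityAt_affine {ν μ : Measure ℝ} {α c z : ℝ} {β : ℝ≥0∞} (hα : 0 < α) (hβ : β ≠ ⊤)
    (h : ∀ a b, ν (Icc (c + α * a) (c + α * b)) = β * μ (Icc a b)) :
    densityAt ν (c + α * z) = β / ENNReal.ofReal α * densityAt μ z := by
  have hα0 : ENNReal.ofReal α ≠ 0 := by simpa using hα
  let e : ℝ ≃ₜ ℝ := (Homeomorph.mulLeft₀ α hα.ne').trans (Homeomorph.addLeft c)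
  have he : ∀ x, e x = c + α * x := fun x => rfl
  have h1 : map (e.prodCongr e) (𝓝[{q : ℝ × ℝ | q.1 < q.2}] (z, z)) =
      𝓝[{q : ℝ × ℝ | q.1 < q.2}] (c + α * z, c + α * z) := by
    rw [(e.prodCongr e).isEmbedding.map_nhdsWithin_eq, Homeomorph.image_eq_preimage_symm]
    congr 1
    ext q
    obtain ⟨q, rfl⟩ := (e.prodCongr e).surjective q
    rw [mem_preimage, Homeomorph.symm_apply_apply]
    simp [he, hα]
  unfold densityAt
  rw [← h1, ← ENNReal.limsup_const_mul_of_ne_top (ENNReal.div_ne_top hβ hα0), limsup, limsup,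
    map_map]
  congr 1
  congr 1
  ext q
  have h2 : c + α * q.2 - (c + α * q.1) = α * (q.2 - q.1) := by ring
  simp only [Function.comp, Homeomorph.coe_prodCongr, Prod.map, he, h, h2]
  rw [ENNReal.ofReal_mul hα.le, ENNReal.div_eq_inv_mul, ENNReal.div_eq_inv_mul,
    ENNReal.div_eq_inv_mul, ENNReal.mul_inv (Or.inl hα0) (Or.inl (by simp))]
  ring

theorem isModeOf_affine {ν μ : Measure ℝ} {α c z : ℝ} {β : ℝ≥0∞} (hα : 0 < α) (hβ0 : β ≠ 0)
    (hβ : β ≠ ⊤) (h : ∀ a b, ν (Icc (c + α * a) (c + α * b)) = β * μ (Icc a b)) :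
    IsModeOf ν (c + α * z) ↔ IsModeOf μ z := by
  have hα0 : ENNReal.ofReal α ≠ 0 := by simpa using hα
  have k0 : β / ENNReal.ofReal α ≠ 0 := ENNReal.div_ne_zero.2 ⟨hβ0, by simp⟩
  have k1 : β / ENNReal.ofReal α ≠ ⊤ := ENNReal.div_ne_top hβ hα0
  constructor
  · intro H y
    have := H (c + α * y)
    rwa [densityAt_affine hα hβ h, densityAt_affine hα hβ h,
      ENNReal.mul_le_mul_iff_right k0 k1] at this
  · intro H y
    have hy : y = c + α * ((y - c) / α) := by field_simp; ring
    rw [hy, densityAt_affine hα hβ h, densityAt_affine hα hβ h,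
      ENNReal.mul_le_mul_iff_right k0 k1]
    exact H _

/-! ### Mean values and strong concavity on an interval -/

/-- The mean value theorem irrespective of the order of the two points. The sign condition records
that the intermediate point is on the same side of `x` as `y`. -/
theorem exists_hasDerivAt_sub_eq_mul {S : Set ℝ} (hS : S.OrdConnected) {f f' : ℝ → ℝ}
    (hf : ∀ x ∈ S, HasDerivAt f (f' x) x) {x y : ℝ} (hx : x ∈ S) (hy : y ∈ S) :
    ∃ ζ ∈ S, 0 ≤ (ζ - x) * (y - x) ∧ f y - f x = f' ζ * (y - x) := by
  rcases lt_trichotomy x y with h | rfl | h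
  · have hsub : Icc x y ⊆ S := hS.out hx hy
    obtain ⟨ζ, hζ, e⟩ := exists_hasDerivAt_eq_slope f f' h
      (fun z hz => (hf z (hsub hz)).continuousAt.continuousWithinAt)
      (fun z hz => hf z (hsub (Ioo_subset_Icc_self hz)))
    have : y - x ≠ 0 := by linarith
    exact ⟨ζ, hsub (Ioo_subset_Icc_self hζ), by nlinarith [hζ.1], by rw [e]; field_simp⟩
  · exact ⟨x, hx, by simp, by simp⟩
  · have hsub : Icc y x ⊆ S := hS.out hy hx
    obtain ⟨ζ, hζ, e⟩ := exists_hasDerivAt_eq_slope f f' h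
      (fun z hz => (hf z (hsub hz)).continuousAt.continuousWithinAt)
      (fun z hz => hf z (hsub (Ioo_subset_Icc_self hz)))
    have : x - y ≠ 0 := by linarith
    exact ⟨ζ, hsub (Ioo_subset_Icc_self hζ), by nlinarith [hζ.2], by rw [e]; field_simp; ring⟩

/-- The difference of `f` and the parabola vanishes at `x`. Two mean values show that its derivative
at an intermediate point has the sign opposite to `y - x`, or is zero. -/
theorem le_tangent_sub_sq {S : Set ℝ} (hS : S.OrdConnected) {f f' f'' : ℝ → ℝ} {κ : ℝ}
    (hf : ∀ x ∈ S, HasDerivAt f (f' x) x) (hf' : ∀ x ∈ S, HasDerivAt f' (f'' x) x)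
    (hκ : ∀ x ∈ S, f'' x ≤ -(2 * κ)) {x y : ℝ} (hx : x ∈ S) (hy : y ∈ S) :
    f y ≤ f x + f' x * (y - x) - κ * (y - x) ^ 2 := by
  have h1 : ∀ z ∈ S, HasDerivAt (fun z => f z - f' x * (z - x) + κ * (z - x) ^ 2)
      (f' z - f' x + 2 * κ * (z - x)) z := by
    intro z hz
    have e1 : HasDerivAt (fun z => z - x) 1 z := (hasDerivAt_id z).sub_const x
    refine (((hf z hz).sub (e1.const_mul (f' x))).add ((e1.pow 2).const_mul κ)).congr_deriv ?_
    ring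
  obtain ⟨ζ, hζ, s1, e1⟩ := exists_hasDerivAt_sub_eq_mul hS h1 hx hy
  obtain ⟨θ, hθ, -, e2⟩ := exists_hasDerivAt_sub_eq_mul hS hf' hx hζ
  have h2 : (f' ζ - f' x + 2 * κ * (ζ - x)) * (y - x) ≤ 0 := by
    rw [e2]
    nlinarith [hκ θ hθ]
  rw [← e1] at h2
  simp only [sub_self, mul_zero, ne_eq, OfNat.ofNat_ne_zero, not_false_eq_true, zero_pow] at h2
  linarith

/-! ### The half chord and its derivatives -/

/-- Half the length of the chord of the unit disc at distance `|x|` from the centre. -/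
noncomputable def halfChord (x : ℝ) : ℝ := Real.sqrt (1 - x ^ 2)

theorem continuous_halfChord : Continuous halfChord := by
  unfold halfChord; fun_prop

theorem halfChord_nonneg (x : ℝ) : 0 ≤ halfChord x := Real.sqrt_nonneg _

theorem halfChord_le_one (x : ℝ) : halfChord x ≤ 1 := by
  exact Real.sqrt_le_one.2 (by nlinarith [sq_nonneg x])

theorem halfChord_sq {x : ℝ} (hx : |x| ≤ 1) : halfChord x ^ 2 = 1 - x ^ 2 := by
  rw [halfChord, Real.sq_sqrt]
  nlinarith [sq_abs x, abs_nonneg x]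

theorem halfChord_pos {x : ℝ} (hx : |x| < 1) : 0 < halfChord x := by
  rw [halfChord, Real.sqrt_pos]
  nlinarith [sq_abs x, abs_nonneg x]

theorem one_sub_sq_le_halfChord {x : ℝ} (hx : |x| ≤ 1) : 1 - x ^ 2 ≤ halfChord x := by
  rw [← halfChord_sq hx]
  nlinarith [halfChord_nonneg x, halfChord_le_one x]

theorem hasDerivAt_halfChord {x : ℝ} (hx : |x| < 1) :
    HasDerivAt halfChord (-x / halfChord x) x := by
  have h := halfChord_pos hx
  have h0 : 1 - x ^ 2 ≠ 0 := by rw [← halfChord_sq hx.le]; positivity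
  have h1 : HasDerivAt (fun x : ℝ => 1 - x ^ 2) (-(2 * x)) x := by
    simpa using (hasDerivAt_pow 2 x).const_sub 1
  refine (h1.sqrt h0).congr_deriv ?_
  change -(2 * x) / (2 * halfChord x) = -x / halfChord x
  field_simp

theorem hasDerivAt_halfChord_deriv {x : ℝ} (hx : |x| < 1) :
    HasDerivAt (fun x => -x / halfChord x) (-1 / halfChord x ^ 3) x := by
  have h := halfChord_pos hx
  refine ((hasDerivAt_neg x).div (hasDerivAt_halfChord hx) h.ne').congr_deriv ?_
  have := halfChord_sq hx.le
  field_simp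
  linarith

theorem hasDerivAt_halfChord_deriv_two {x : ℝ} (hx : |x| < 1) :
    HasDerivAt (fun x => -1 / halfChord x ^ 3) (-3 * x / halfChord x ^ 5) x := by
  have h := halfChord_pos hx
  refine ((hasDerivAt_const x (-1 : ℝ)).div ((hasDerivAt_halfChord hx).pow 3)
    (pow_ne_zero 3 h.ne')).congr_deriv ?_
  simp only [Pi.pow_apply]
  field_simp
  ring

theorem halfChord_ge {x : ℝ} (hx : |x| ≤ 1 / 2) : 43 / 50 ≤ halfChord x := by
  have h1 := halfChord_sq (hx.trans (by norm_num))
  have h2 := halfChord_nonneg x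
  have : x ^ 2 ≤ 1 / 4 := by nlinarith [sq_abs x, abs_nonneg x]
  nlinarith

theorem abs_halfChord_deriv_le {x : ℝ} (hx : |x| ≤ 1 / 2) : |-x / halfChord x| ≤ 3 / 5 := by
  have h := halfChord_ge hx
  rw [abs_div, abs_neg, abs_of_pos (by linarith : 0 < halfChord x), div_le_iff₀ (by linarith)]
  linarith

/-! ### Densities of images under nearly linear functions -/

/-- The hypotheses on the restriction `ψ` of a nearly linear function to a curve crossing the disc,
with its first three derivatives. -/
structure NearlyLinear (ψ P P1 P2 : ℝ → ℝ) (ε : ℝ) : Prop where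
  small : ε ≤ 1 / 100
  abs_sub_le : ∀ x, |x| ≤ 1 → |ψ x - x| ≤ ε
  deriv_zero : ∀ x, |x| ≤ 1 / 2 → HasDerivAt ψ (P x) x
  deriv_one : ∀ x, |x| ≤ 1 / 2 → HasDerivAt P (P1 x) x
  deriv_two : ∀ x, |x| ≤ 1 / 2 → HasDerivAt P1 (P2 x) x
  bound_one : ∀ x, |x| ≤ 1 / 2 → |P x - 1| ≤ ε
  bound_two : ∀ x, |x| ≤ 1 / 2 → |P1 x| ≤ ε
  bound_three : ∀ x, |x| ≤ 1 / 2 → |P2 x| ≤ ε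

theorem ordConnected_abs_le (r : ℝ) : {x : ℝ | |x| ≤ r}.OrdConnected := by
  have : {x : ℝ | |x| ≤ r} = Icc (-r) r := by ext; simp [abs_le]
  rw [this]; exact ordConnected_Icc

theorem ordConnected_abs_lt (r : ℝ) : {x : ℝ | |x| < r}.OrdConnected := by
  have : {x : ℝ | |x| < r} = Ioo (-r) r := by ext; simp [abs_lt]
  rw [this]; exact ordConnected_Ioo

namespace NearlyLinear

variable {ψ P P1 P2 : ℝ → ℝ} {ε : ℝ}

theorem nonneg (h : NearlyLinear ψ P P1 P2 ε) : 0 ≤ ε :=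
  (abs_nonneg _).trans (h.abs_sub_le 0 (by simp))

theorem lower_mul_sub_le (h : NearlyLinear ψ P P1 P2 ε) {x y : ℝ} (hx : |x| ≤ 1 / 2)
    (hy : |y| ≤ 1 / 2) (hxy : x ≤ y) : 99 / 100 * (y - x) ≤ ψ y - ψ x := by
  obtain ⟨ζ, hζ, -, e⟩ := exists_hasDerivAt_sub_eq_mul (ordConnected_abs_le (1 / 2))
    h.deriv_zero hx hy
  rw [e]
  have := (abs_le.1 (h.bound_one ζ hζ)).1
  have := h.small
  nlinarith

theorem le_iff (h : NearlyLinear ψ P P1 P2 ε) {x y : ℝ} (hx : |x| ≤ 1 / 2)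
    (hy : |y| ≤ 1 / 2) : ψ x ≤ ψ y ↔ x ≤ y := by
  constructor
  · intro hle
    by_contra! hlt
    linarith [h.lower_mul_sub_le hy hx hlt.le]
  · intro hle
    linarith [h.lower_mul_sub_le hx hy hle]

/-- The values at `±1/2` straddle `[-2/5, 2/5]`, so the intermediate value theorem gives a preimage;
it is within 1/100 of `s`, hence the bound 41/100. -/
theorem exists_inverse (h : NearlyLinear ψ P P1 P2 ε) :
    ∃ X : ℝ → ℝ, ∀ s, |s| < 2 / 5 → |X s| ≤ 41 / 100 ∧ ψ (X s) = s := by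
  have hc : ContinuousOn ψ (Icc (-(1 / 2)) (1 / 2)) := fun x hx =>
    (h.deriv_zero x (abs_le.2 hx)).continuousAt.continuousWithinAt
  have key : ∀ s, ∃ x : ℝ, |s| < 2 / 5 → |x| ≤ 41 / 100 ∧ ψ x = s := by
    intro s
    by_cases hs : |s| < 2 / 5
    · have h1 := h.abs_sub_le (-(1 / 2)) (by rw [abs_le]; norm_num)
      have h2 := h.abs_sub_le (1 / 2) (by rw [abs_le]; norm_num)
      have hsm := h.small
      rw [abs_le] at h1 h2
      rw [abs_lt] at hs
      obtain ⟨x, hx, hxs⟩ := intermediate_value_Icc (by norm_num) hc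
        (show s ∈ Icc (ψ (-(1 / 2))) (ψ (1 / 2)) from ⟨by linarith, by linarith⟩)
      refine ⟨x, fun _ => ⟨?_, hxs⟩⟩
      have h3 := h.abs_sub_le x (abs_le.2 ⟨by linarith [hx.1], by linarith [hx.2]⟩)
      rw [abs_le] at h3 ⊢
      constructor <;> linarith
    · exact ⟨0, fun hs' => absurd hs' hs⟩
  choose X hX using key
  exact ⟨X, hX⟩

theorem hasDerivAt_inverse (h : NearlyLinear ψ P P1 P2 ε) {X : ℝ → ℝ}
    (hX : ∀ s, |s| < 2 / 5 → |X s| ≤ 41 / 100 ∧ ψ (X s) = s) {s : ℝ} (hs : |s| < 2 / 5) :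
    HasDerivAt X (P (X s))⁻¹ s := by
  have hJ : {s : ℝ | |s| < 2 / 5} ∈ 𝓝 s := (isOpen_lt continuous_abs continuous_const).mem_nhds hs
  have hle : ∀ s, |s| < 2 / 5 → |X s| ≤ 1 / 2 := fun s hs => (hX s hs).1.trans (by norm_num)
  have hP := (abs_le.1 (h.bound_one (X s) (hle s hs))).1
  have hsm := h.small
  refine HasDerivAt.of_local_left_inverse (f := ψ) ?_ (h.deriv_zero _ (hle s hs)) (by linarith) ?_
  -- The inverse is only a choice of preimages; its continuity comes from the lower bound on the
  -- slope of `ψ`, which makes it Lipschitz.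
  · have hb : ∀ s', |s'| < 2 / 5 → dist (X s') (X s) ≤ 2 * dist s' s := by
      intro s' hs'
      rw [Real.dist_eq, Real.dist_eq]
      rcases le_total (X s) (X s') with hh | hh
      · have := h.lower_mul_sub_le (hle s hs) (hle s' hs') hh
        rw [(hX s hs).2, (hX s' hs').2] at this
        rw [abs_of_nonneg (by linarith)]
        linarith [le_abs_self (s' - s)]
      · have := h.lower_mul_sub_le (hle s' hs') (hle s hs) hh
        rw [(hX s hs).2, (hX s' hs').2] at this
        rw [abs_of_nonpos (by linarith)]
        linarith [neg_abs_le (s' - s)]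
    rw [ContinuousAt, tendsto_iff_dist_tendsto_zero]
    refine squeeze_zero' (Eventually.of_forall fun _ => dist_nonneg)
      (by filter_upwards [hJ] with s' hs' using hb s' hs') ?_
    have : Tendsto (fun s' => 2 * dist s' s) (𝓝 s) (𝓝 (2 * dist s s)) :=
      ((continuous_id.dist continuous_const).const_mul 2).tendsto s
    simpa using this
  · filter_upwards [hJ] with s' hs' using (hX s' hs').2

theorem hasDerivAt_weight (h : NearlyLinear ψ P P1 P2 ε) {x : ℝ} (hx : |x| ≤ 1 / 2) :
    HasDerivAt (fun x => halfChord x / P x)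
      ((-x / halfChord x * P x - halfChord x * P1 x) / P x ^ 2) x := by
  have hP := (abs_le.1 (h.bound_one x hx)).1
  have hsm := h.small
  exact (hasDerivAt_halfChord (by linarith)).div (h.deriv_one x hx) (by linarith)

/-- The third power of `P` is there because the quotient is the derivative of `w/P` with respect to
the value `s`: one more factor `1/P` from `dx/ds`. -/
theorem hasDerivAt_weight_deriv (h : NearlyLinear ψ P P1 P2 ε) {x : ℝ} (hx : |x| ≤ 1 / 2) :
    HasDerivAt (fun x => (-x / halfChord x * P x - halfChord x * P1 x) / P x ^ 3)
      (((-1 / halfChord x ^ 3 * P x - halfChord x * P2 x) * P x -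
        3 * P1 x * (-x / halfChord x * P x - halfChord x * P1 x)) / P x ^ 4) x := by
  have hP := (abs_le.1 (h.bound_one x hx)).1
  have hsm := h.small
  have hP0 : P x ≠ 0 := by linarith
  have hx1 : |x| < 1 := by linarith
  refine ((((hasDerivAt_halfChord_deriv hx1).mul (h.deriv_one x hx)).sub
    ((hasDerivAt_halfChord hx1).mul (h.deriv_two x hx))).div ((h.deriv_one x hx).pow 3)
    (pow_ne_zero 3 hP0)).congr_deriv ?_
  simp only [Pi.pow_apply, Pi.mul_apply, Pi.sub_apply]
  have := (halfChord_pos hx1).ne'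
  generalize -x / halfChord x = A
  field_simp
  ring

theorem abs_weight_num_le (h : NearlyLinear ψ P P1 P2 ε) {x : ℝ} (hx : |x| ≤ 1 / 2) :
    |-x / halfChord x * P x - halfChord x * P1 x| ≤ 63 / 100 := by
  have hP := abs_le.1 (h.bound_one x hx)
  have hsm := h.small
  have h1 := abs_halfChord_deriv_le hx
  have h2 : |halfChord x * P1 x| ≤ 1 * (1 / 100) := by
    rw [abs_mul]
    exact mul_le_mul (by rw [abs_of_nonneg (halfChord_nonneg x)]; exact halfChord_le_one x)
      ((h.bound_two x hx).trans hsm) (abs_nonneg _) (by norm_num)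
  have h3 : |-x / halfChord x * P x| ≤ 3 / 5 * (101 / 100) := by
    rw [abs_mul]
    exact mul_le_mul h1 (by rw [abs_le]; constructor <;> linarith) (abs_nonneg _) (by norm_num)
  refine (abs_sub _ _).trans ?_
  linarith

theorem abs_weight_deriv_le (h : NearlyLinear ψ P P1 P2 ε) {x : ℝ} (hx : |x| ≤ 1 / 2) :
    |(-x / halfChord x * P x - halfChord x * P1 x) / P x ^ 3| ≤ 1 := by
  have hP := abs_le.1 (h.bound_one x hx)
  have hsm := h.small
  have h1 : (99 / 100 : ℝ) ^ 3 ≤ P x ^ 3 := pow_le_pow_left₀ (by norm_num) (by linarith) 3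
  have h2 : (0 : ℝ) < P x ^ 3 := lt_of_lt_of_le (by norm_num) h1
  rw [abs_div, abs_of_pos h2, div_le_one h2]
  refine (h.abs_weight_num_le hx).trans (le_trans (by norm_num) h1)

/-- The term `-1/w³ ≤ -1`, from the concavity of `w`, dominates; all others carry `P1` or `P2`, at
most 1/100. The bound has ample room and fixes the concavity constant 1/4 used below. -/
theorem weight_deriv_two_le (h : NearlyLinear ψ P P1 P2 ε) {x : ℝ} (hx : |x| ≤ 1 / 2) :
    (((-1 / halfChord x ^ 3 * P x - halfChord x * P2 x) * P x -
        3 * P1 x * (-x / halfChord x * P x - halfChord x * P1 x)) / P x ^ 4) * (P x)⁻¹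
      ≤ -(2 * (1 / 4)) := by
  have hP := abs_le.1 (h.bound_one x hx)
  have hsm := h.small
  have hw := halfChord_ge hx
  have hw1 := halfChord_le_one x
  have hP0 : 0 < P x := by linarith
  have h1 : P x ^ 5 ≤ (101 / 100) ^ 5 := pow_le_pow_left₀ hP0.le (by linarith) 5
  have h2 : |3 * P1 x * (-x / halfChord x * P x - halfChord x * P1 x)| ≤
      3 * (1 / 100) * (63 / 100) := by
    rw [abs_mul, abs_mul, abs_of_pos (by norm_num : (0 : ℝ) < 3)]
    exact mul_le_mul (by linarith [(h.bound_two x hx).trans hsm]) (h.abs_weight_num_le hx)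
      (abs_nonneg _) (by norm_num)
  have h3 : |halfChord x * P2 x| ≤ 1 * (1 / 100) := by
    rw [abs_mul]
    exact mul_le_mul (by rw [abs_of_nonneg (halfChord_nonneg x)]; exact hw1)
      ((h.bound_three x hx).trans hsm) (abs_nonneg _) (by norm_num)
  have h4 : -1 / halfChord x ^ 3 ≤ -1 := by
    rw [div_le_iff₀ (by positivity)]
    have : halfChord x ^ 3 ≤ 1 := pow_le_one₀ (by linarith) hw1
    linarith
  have h5 : -1 / halfChord x ^ 3 * P x - halfChord x * P2 x ≤ -(98 / 100) := by
    have := (abs_le.1 h3).1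
    nlinarith
  have h6 : (-1 / halfChord x ^ 3 * P x - halfChord x * P2 x) * P x ≤ -(97 / 100) := by
    nlinarith
  have h7 := (abs_le.1 h2).1
  rw [div_mul_eq_mul_div, div_le_iff₀ (by positivity), mul_inv_le_iff₀ hP0]
  have h8 : P x ^ 4 * P x = P x ^ 5 := by ring
  have h9 : ((101 / 100 : ℝ)) ^ 5 ≤ 11 / 10 := by norm_num
  nlinarith

/-- Closeness of `ψ` to the identity on all of `[-1, 1]` forces every preimage of these values into
`[-1/2, 1/2]`, where `ψ` is increasing. -/
theorem setOf_mem_Icc_eq (h : NearlyLinear ψ P P1 P2 ε) {X : ℝ → ℝ}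
    (hX : ∀ s, |s| < 2 / 5 → |X s| ≤ 41 / 100 ∧ ψ (X s) = s) {a b : ℝ} (ha : |a| < 2 / 5)
    (hb : |b| < 2 / 5) : {x | |x| < 1 ∧ ψ x ∈ Icc a b} = Icc (X a) (X b) := by
  have hle : ∀ s, |s| < 2 / 5 → |X s| ≤ 1 / 2 := fun s hs => (hX s hs).1.trans (by norm_num)
  have hsm := h.small
  ext x
  simp only [mem_ofPred_eq, mem_Icc]
  constructor
  · rintro ⟨hx, h1, h2⟩
    have h3 := abs_le.1 (h.abs_sub_le x hx.le)
    rw [abs_lt] at ha hb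
    have hx2 : |x| ≤ 1 / 2 := by rw [abs_le]; constructor <;> linarith
    rw [← abs_lt] at ha hb
    rw [← h.le_iff (hle a ha) hx2, ← h.le_iff hx2 (hle b hb), (hX a ha).2, (hX b hb).2]
    exact ⟨h1, h2⟩
  · rintro ⟨h1, h2⟩
    have h3 := abs_le.1 (hle a ha)
    have h4 := abs_le.1 (hle b hb)
    have hx2 : |x| ≤ 1 / 2 := by rw [abs_le]; constructor <;> linarith
    rw [← h.le_iff (hle a ha) hx2, (hX a ha).2] at h1
    rw [← h.le_iff hx2 (hle b hb), (hX b hb).2] at h2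
    exact ⟨by linarith, h1, h2⟩

theorem lintegral_halfChord_Icc {a b : ℝ} (hab : a ≤ b) :
    ∫⁻ x in Icc a b, ENNReal.ofReal (halfChord x) =
      ENNReal.ofReal ((∫ x in (0 : ℝ)..b, halfChord x) - ∫ x in (0 : ℝ)..a, halfChord x) := by
  have hi : ∀ a b, IntervalIntegrable halfChord volume a b := fun a b =>
    continuous_halfChord.intervalIntegrable a b
  rw [intervalIntegral.integral_interval_sub_left (hi _ _) (hi _ _),
    intervalIntegral.integral_of_le hab, ← integral_Icc_eq_integral_Ioc,
    ofReal_integral_eq_lintegral_ofReal]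
  · exact continuous_halfChord.integrableOn_Icc
  · exact Eventually.of_forall halfChord_nonneg

/-- To first order `w' ≈ -x`, `w ≈ 1`, `P ≈ 1` and `x ≈ s - ψ 0`, so the derivative of the density
is `-(s - ψ 0) - P1 x` up to products of two small quantities. -/
theorem weight_deriv_expansion (h : NearlyLinear ψ P P1 P2 ε) {x s : ℝ} (hx : |x| ≤ 1 / 2)
    (hs : ψ x = s) :
    |x| ≤ 2 * (|s| + ε) ∧
    |(-x / halfChord x * P x - halfChord x * P1 x) / P x ^ 3 + (s - ψ 0) + P1 x| ≤
      20 * (|s| + ε) ^ 2 := by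
  have hε := h.nonneg
  have hsm := h.small
  set σ := |s| + ε with hσ
  have hεσ : ε ≤ σ := by linarith [abs_nonneg s]
  obtain ⟨ζ, hζ, -, e⟩ := exists_hasDerivAt_sub_eq_mul (ordConnected_abs_le (1 / 2))
    h.deriv_zero (x := 0) (by simp) hx
  rw [hs, sub_zero] at e
  have hPζ := h.bound_one ζ hζ
  have hP := h.bound_one x hx
  have h0 : |s - ψ 0| ≤ σ := by
    have := h.abs_sub_le 0 (by simp)
    rw [sub_zero] at this
    exact (abs_sub _ _).trans (by linarith)
  have hxσ : |x| ≤ 51 / 50 * σ := by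
    rw [e, abs_mul] at h0
    have h1 : 99 / 100 ≤ |P ζ| := by
      have := (abs_le.1 hPζ).1
      exact le_trans (by linarith) (le_abs_self _)
    nlinarith [abs_nonneg x]
  refine ⟨by linarith, ?_⟩
  have hsx : |s - ψ 0 - x| ≤ 51 / 50 * σ ^ 2 := by
    have : s - ψ 0 - x = (P ζ - 1) * x := by rw [e]; ring
    rw [this, abs_mul]
    nlinarith [mul_le_mul hPζ hxσ (abs_nonneg _) hε]
  have hw := halfChord_ge hx
  have hw1 := halfChord_le_one x
  have hwx := one_sub_sq_le_halfChord (x := x) (by linarith)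
  have hxx : x ^ 2 ≤ 1 / 2 * |x| := by rw [← sq_abs]; nlinarith [abs_nonneg x]
  have hP' := abs_le.1 hP
  have hw' : |1 - (halfChord x)⁻¹| ≤ 3 / 5 * |x| := by
    have e1 : 1 - (halfChord x)⁻¹ = (halfChord x - 1) / halfChord x := by field_simp
    rw [e1, abs_div, abs_of_pos (by linarith : 0 < halfChord x), div_le_iff₀ (by linarith),
      abs_of_nonpos (by linarith)]
    nlinarith [abs_nonneg x]
  have hP2 : |P x ^ 2 - 1| ≤ 201 / 100 * ε := by
    have e1 : P x ^ 2 - 1 = (P x - 1) * (P x + 1) := by ring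
    rw [e1, abs_mul, mul_comm]
    exact mul_le_mul (by rw [abs_le]; constructor <;> linarith) hP (abs_nonneg _) (by norm_num)
  have hP3 : |P x ^ 3 - 1| ≤ 4 * ε := by
    have e1 : P x ^ 3 - 1 = (P x ^ 2 + P x + 1) * (P x - 1) := by ring
    rw [e1, abs_mul]
    exact mul_le_mul (by rw [abs_le]; constructor <;> nlinarith) hP (abs_nonneg _) (by norm_num)
  have hP30 : (9 / 10 : ℝ) ≤ P x ^ 3 :=
    le_trans (by norm_num) (pow_le_pow_left₀ (by norm_num : (0 : ℝ) ≤ 99 / 100) (by linarith) 3)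
  have hA : |(-x / halfChord x * P x - halfChord x * P1 x) / P x ^ 3 + x + P1 x| ≤
      10 * σ ^ 2 := by
    have e1 : (-x / halfChord x * P x - halfChord x * P1 x) / P x ^ 3 + x + P1 x =
        (x * P x * ((P x ^ 2 - 1) + (1 - (halfChord x)⁻¹)) +
          P1 x * ((P x ^ 3 - 1) + (1 - halfChord x))) / P x ^ 3 := by
      have : halfChord x ≠ 0 := by linarith
      have : P x ≠ 0 := by linarith
      field_simp
      ring
    rw [e1, abs_div, abs_of_pos (by linarith : 0 < P x ^ 3), div_le_iff₀ (by linarith)]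
    have b1 : |(P x ^ 2 - 1) + (1 - (halfChord x)⁻¹)| ≤ 3 * σ :=
      (abs_add_le _ _).trans (by linarith)
    have b2 : |(P x ^ 3 - 1) + (1 - halfChord x)| ≤ 5 * σ := by
      have : |1 - halfChord x| ≤ x ^ 2 := by
        rw [abs_of_nonneg (by linarith)]; linarith
      exact (abs_add_le _ _).trans (by linarith)
    have b3 : |x * P x * ((P x ^ 2 - 1) + (1 - (halfChord x)⁻¹))| ≤
        (51 / 50 * σ * (101 / 100)) * (3 * σ) := by
      rw [abs_mul, abs_mul]
      have : |P x| ≤ 101 / 100 := by rw [abs_le]; constructor <;> linarith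
      gcongr
    have b4 : |P1 x * ((P x ^ 3 - 1) + (1 - halfChord x))| ≤ σ * (5 * σ) := by
      rw [abs_mul]
      have := (h.bound_two x hx).trans hεσ
      gcongr
    refine (abs_add_le _ _).trans ((add_le_add b3 b4).trans ?_)
    nlinarith [sq_nonneg σ]
  have e2 : (-x / halfChord x * P x - halfChord x * P1 x) / P x ^ 3 + (s - ψ 0) + P1 x =
      ((-x / halfChord x * P x - halfChord x * P1 x) / P x ^ 3 + x + P1 x) + (s - ψ 0 - x) := by
    ring
  rw [e2]
  refine (abs_add_le _ _).trans ?_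
  nlinarith [sq_nonneg σ]

/-- Here `φ` is the density of the image measure and `q` its derivative. The clauses give, in order,
local uniform approximation by `φ`, strong concavity, the height at the centre, boundedness, and the
expansion of the slope. -/
theorem exists_density (h : NearlyLinear ψ P P1 P2 ε) :
    ∃ φ q : ℝ → ℝ,
      (∀ s δ a b, |s| < 2 / 5 → |a| < 2 / 5 → |b| < 2 / 5 → a ≤ b → s - δ < a → b < s + δ →
        ∃ r, 0 ≤ r ∧ |r - (b - a) * φ s| ≤ δ * (b - a) ∧
          ∫⁻ x in {x | |x| < 1 ∧ ψ x ∈ Icc a b}, ENNReal.ofReal (halfChord x) =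
            ENNReal.ofReal r) ∧
      (∀ s s', |s| < 2 / 5 → |s'| < 2 / 5 →
        φ s' ≤ φ s + q s * (s' - s) - 1 / 4 * (s' - s) ^ 2) ∧
      197 / 200 ≤ φ 0 ∧ (∀ s, |s| < 2 / 5 → 0 ≤ φ s ∧ φ s ≤ 2) ∧
      ∀ s, |s| < 2 / 5 → ∃ x, |x| ≤ 1 / 2 ∧ |x| ≤ 2 * (|s| + ε) ∧
        |q s + (s - ψ 0) + P1 x| ≤ 20 * (|s| + ε) ^ 2 := by
  obtain ⟨X, hX⟩ := h.exists_inverse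
  have hle : ∀ s, |s| < 2 / 5 → |X s| ≤ 1 / 2 := fun s hs => (hX s hs).1.trans (by norm_num)
  have hsm := h.small
  set J : Set ℝ := {s | |s| < 2 / 5} with hJ
  have hφ : ∀ s ∈ J, HasDerivAt (fun s => halfChord (X s) / P (X s))
      ((-X s / halfChord (X s) * P (X s) - halfChord (X s) * P1 (X s)) / P (X s) ^ 3) s := by
    intro s hs
    refine ((h.hasDerivAt_weight (hle s hs)).comp s (h.hasDerivAt_inverse hX hs)).congr_deriv ?_
    rw [← div_eq_mul_inv, div_div, ← pow_succ]
  refine ⟨fun s => halfChord (X s) / P (X s),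
    fun s => (-X s / halfChord (X s) * P (X s) - halfChord (X s) * P1 (X s)) / P (X s) ^ 3,
    ?_, ?_, ?_, ?_, ?_⟩
  · intro s δ a b hs ha hb hab h1 h2
    have hXab : X a ≤ X b := by
      rw [← h.le_iff (hle a ha) (hle b hb), (hX a ha).2, (hX b hb).2]; exact hab
    have hG : ∀ s ∈ J, HasDerivAt (fun s => ∫ x in (0 : ℝ)..X s, halfChord x)
        (halfChord (X s) / P (X s)) s := by
      intro s hs
      exact (intervalIntegral.integral_hasDerivAt_right
        (continuous_halfChord.intervalIntegrable _ _)
        (continuous_halfChord.stronglyMeasurableAtFilter _ _)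
        continuous_halfChord.continuousAt).comp s (h.hasDerivAt_inverse hX hs)
    -- The mass is `φ ζ * (b - a)` for some `ζ` in `[a, b]`; a second mean value with `|φ'| ≤ 1`
    -- compares `φ ζ` with `φ s`.
    obtain ⟨ζ, hζ, s1, e1⟩ := exists_hasDerivAt_sub_eq_mul (S := J ∩ Icc a b)
      ((ordConnected_abs_lt _).inter ordConnected_Icc) (fun x hx => hG x hx.1)
      (x := a) (y := b) ⟨ha, left_mem_Icc.2 hab⟩ ⟨hb, right_mem_Icc.2 hab⟩
    obtain ⟨θ, hθ, -, e2⟩ := exists_hasDerivAt_sub_eq_mul (ordConnected_abs_lt _) hφ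
      (x := s) (y := ζ) hs hζ.1
    refine ⟨_, ?_, ?_, (by rw [h.setOf_mem_Icc_eq hX ha hb]; exact lintegral_halfChord_Icc hXab)⟩
    · rw [e1]
      have := (abs_le.1 (h.bound_one (X ζ) (hle ζ hζ.1))).1
      have := halfChord_nonneg (X ζ)
      exact mul_nonneg (div_nonneg this (by linarith)) (by linarith)
    · rw [e1]
      have e3 : ∀ u v : ℝ, u * (b - a) - (b - a) * v = (u - v) * (b - a) := fun u v => by ring
      rw [e3, abs_mul, abs_of_nonneg (sub_nonneg.2 hab), e2, abs_mul]
      refine mul_le_mul_of_nonneg_right ?_ (sub_nonneg.2 hab)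
      have h3 : |ζ - s| ≤ δ := by
        rw [abs_le]; constructor <;> linarith [hζ.2.1, hζ.2.2]
      have h4 := h.abs_weight_deriv_le (hle θ hθ)
      nlinarith [abs_nonneg (ζ - s)]
  · intro s s' hs hs'
    refine le_tangent_sub_sq (ordConnected_abs_lt (2 / 5))
      (f'' := fun x => ((((-1 / halfChord (X x) ^ 3 * P (X x) - halfChord (X x) * P2 (X x)) *
        P (X x) - 3 * P1 (X x) * (-X x / halfChord (X x) * P (X x) - halfChord (X x) * P1 (X x)))
        / P (X x) ^ 4) * (P (X x))⁻¹)) hφ (fun x hx => ?_) (fun x hx => ?_) hs hs'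
    · exact (h.hasDerivAt_weight_deriv (hle x hx)).comp x (h.hasDerivAt_inverse hX hx)
    · exact h.weight_deriv_two_le (hle x hx)
  · have h0 : |(0 : ℝ)| < 2 / 5 := by norm_num
    have h1 := h.abs_sub_le (X 0) ((hle 0 h0).trans (by norm_num))
    rw [(hX 0 h0).2, zero_sub, abs_neg] at h1
    have h2 := one_sub_sq_le_halfChord ((hle 0 h0).trans (by norm_num))
    have h3 := abs_le.1 (h.bound_one _ (hle 0 h0))
    have h4 : X 0 ^ 2 ≤ 1 / 10000 := by rw [← sq_abs]; nlinarith [abs_nonneg (X 0)]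
    simp only
    rw [le_div_iff₀ (by linarith)]
    linarith
  · intro s hs
    have h3 := abs_le.1 (h.bound_one _ (hle s hs))
    have hP0 : 0 < P (X s) := by linarith
    refine ⟨div_nonneg (halfChord_nonneg _) hP0.le, ?_⟩
    rw [div_le_iff₀ hP0]
    linarith [halfChord_le_one (X s)]
  · intro s hs
    exact ⟨X s, hle s hs, h.weight_deriv_expansion (hle s hs) (hX s hs).2⟩

end NearlyLinear

/-! ### Value distributions over the unit disc and their slices -/

/-- The closed unit disc in the plane with its coordinates as a pair. -/
def unitDisc : Set (ℝ × ℝ) := {p | p.1 ^ 2 + p.2 ^ 2 ≤ 1}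

theorem isCompact_unitDisc : IsCompact unitDisc := by
  refine (isCompact_Icc (a := ((-1 : ℝ), (-1 : ℝ))) (b := (1, 1))).of_isClosed_subset
    (isClosed_le (by fun_prop) (by fun_prop)) ?_
  rintro ⟨x, y⟩ h
  simp only [unitDisc, mem_ofPred_eq] at h
  refine ⟨⟨?_, ?_⟩, ⟨?_, ?_⟩⟩ <;> simp only <;> nlinarith [sq_nonneg x, sq_nonneg y]

theorem measurableSet_unitDisc : MeasurableSet unitDisc := isCompact_unitDisc.measurableSet

instance isFiniteMeasure_restrict_unitDisc :
    IsFiniteMeasure ((volume : Measure (ℝ × ℝ)).restrict unitDisc) :=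
  ⟨by simpa using isCompact_unitDisc.measure_lt_top⟩

/-- The distribution of the values of a function over the unit disc. -/
noncomputable def discDistribution (V : ℝ × ℝ → ℝ) : Measure ℝ :=
  (volume.restrict unitDisc).map V

instance isFiniteMeasure_discDistribution (V : ℝ × ℝ → ℝ) :
    IsFiniteMeasure (discDistribution V) := by
  unfold discDistribution; infer_instance

theorem discDistribution_Icc {V : ℝ × ℝ → ℝ} (hV : Continuous V) (a b : ℝ) :
    discDistribution V (Icc a b) = volume {p : ℝ × ℝ | p ∈ unitDisc ∧ V p ∈ Icc a b} := by
  rw [discDistribution, Measure.map_apply hV.measurable measurableSet_Icc,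
    Measure.restrict_apply (hV.measurable measurableSet_Icc)]
  congr 1
  ext p
  simp [and_comm]

theorem measurableSet_disc_preimage {V : ℝ × ℝ → ℝ} (hV : Continuous V) (a b : ℝ) :
    MeasurableSet {p : ℝ × ℝ | p ∈ unitDisc ∧ V p ∈ Icc a b} :=
  measurableSet_unitDisc.inter (hV.measurable measurableSet_Icc)

/-- The mass that the values in `[a, b]` take along the curve `x ↦ (x, t √(1 - x²))`. -/
noncomputable def sliceMass (V : ℝ × ℝ → ℝ) (a b t : ℝ) : ℝ≥0∞ :=
  ∫⁻ x in {x | |x| < 1 ∧ V (x, t * halfChord x) ∈ Icc a b}, ENNReal.ofReal (halfChord x)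

theorem measurableSet_slice {V : ℝ × ℝ → ℝ} (hV : Continuous V) (a b : ℝ) :
    MeasurableSet {p : ℝ × ℝ | |p.1| < 1 ∧ V (p.1, p.2 * halfChord p.1) ∈ Icc a b} := by
  have hw := continuous_halfChord
  have h1 : Continuous fun p : ℝ × ℝ => V (p.1, p.2 * halfChord p.1) := by fun_prop
  have h2 : MeasurableSet {p : ℝ × ℝ | |p.1| < 1} := measurableSet_lt (by fun_prop) (by fun_prop)
  exact h2.inter (h1.measurable measurableSet_Icc)

theorem sliceMass_eq {V : ℝ × ℝ → ℝ} (hV : Continuous V) (a b t : ℝ) :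
    sliceMass V a b t = ∫⁻ x, {p : ℝ × ℝ | |p.1| < 1 ∧
      V (p.1, p.2 * halfChord p.1) ∈ Icc a b}.indicator
        (fun p => ENNReal.ofReal (halfChord p.1)) (x, t) := by
  rw [sliceMass, ← lintegral_indicator]
  · rfl
  · exact (measurableSet_slice hV a b).preimage (by fun_prop : Measurable fun x : ℝ => (x, t))

theorem measurable_slice_indicator {V : ℝ × ℝ → ℝ} (hV : Continuous V) (a b : ℝ) :
    Measurable ({p : ℝ × ℝ | |p.1| < 1 ∧ V (p.1, p.2 * halfChord p.1) ∈ Icc a b}.indicator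
        (fun p => ENNReal.ofReal (halfChord p.1))) := by
  have hw := continuous_halfChord.measurable
  exact Measurable.indicator (by fun_prop) (measurableSet_slice hV a b)

theorem measurable_sliceMass {V : ℝ × ℝ → ℝ} (hV : Continuous V) (a b : ℝ) :
    Measurable (sliceMass V a b) := by
  have : sliceMass V a b = fun t => ∫⁻ x, {p : ℝ × ℝ | |p.1| < 1 ∧
      V (p.1, p.2 * halfChord p.1) ∈ Icc a b}.indicator
        (fun p => ENNReal.ofReal (halfChord p.1)) (x, t) := funext (sliceMass_eq hV a b)
  rw [this]
  exact (measurable_slice_indicator hV a b).lintegral_prod_left'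

/-- Tonelli, with each vertical section `|y| ≤ w(x)` rescaled to `|t| ≤ 1` by `y = t w(x)`; the
Jacobian `w(x)` becomes the weight in `sliceMass`. -/
theorem discDistribution_Icc_eq_lintegral {V : ℝ × ℝ → ℝ} (hV : Continuous V) (a b : ℝ) :
    discDistribution V (Icc a b) = ∫⁻ t in Icc (-1) 1, sliceMass V a b t := by
  simp_rw [sliceMass_eq hV]
  rw [lintegral_lintegral_swap (f := fun t x => {p : ℝ × ℝ | |p.1| < 1 ∧
        V (p.1, p.2 * halfChord p.1) ∈ Icc a b}.indicator
          (fun p => ENNReal.ofReal (halfChord p.1)) (x, t))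
      (by exact ((measurable_slice_indicator hV a b).comp measurable_swap).aemeasurable),
    discDistribution_Icc hV, Measure.volume_eq_prod,
    Measure.prod_apply (measurableSet_disc_preimage hV a b)]
  refine lintegral_congr_ae ?_
  -- At `x = ±1` the rescaling degenerates; these two abscissae are null.
  have h1 : ∀ᵐ x : ℝ, x ≠ 1 ∧ x ≠ -1 := by
    exact (Measure.ae_ne volume 1).and (Measure.ae_ne volume (-1))
  filter_upwards [h1] with x hx
  by_cases hx1 : |x| < 1
  · have hw := halfChord_pos hx1
    have hsq := halfChord_sq hx1.le
    have hm : MeasurableSet {t : ℝ | V (x, t * halfChord x) ∈ Icc a b} := by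
      have : Continuous fun t => V (x, t * halfChord x) := by fun_prop
      exact this.measurable measurableSet_Icc
    have e1 : Prod.mk x ⁻¹' {p : ℝ × ℝ | p ∈ unitDisc ∧ V p ∈ Icc a b} =
        (fun y => (halfChord x)⁻¹ * y) ⁻¹'
          ({t : ℝ | V (x, t * halfChord x) ∈ Icc a b} ∩ Icc (-1) 1) := by
      ext y
      have e2 : (halfChord x)⁻¹ * y * halfChord x = y := by field_simp
      simp only [mem_preimage, mem_ofPred_eq, mem_inter_iff, e2, unitDisc]
      rw [and_comm]
      refine and_congr_right fun _ => ?_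
      rw [mem_Icc, ← abs_le, abs_mul, abs_inv, abs_of_pos hw, inv_mul_le_iff₀ hw, mul_one,
        ← abs_of_pos hw, ← sq_le_sq, hsq]
      constructor <;> intro h <;> linarith
    rw [e1, Real.volume_preimage_mul_left (inv_ne_zero hw.ne'), inv_inv, abs_of_pos hw]
    have e3 : ∀ t, {p : ℝ × ℝ | |p.1| < 1 ∧ V (p.1, p.2 * halfChord p.1) ∈ Icc a b}.indicator
        (fun p => ENNReal.ofReal (halfChord p.1)) (x, t) =
        {t : ℝ | V (x, t * halfChord x) ∈ Icc a b}.indicator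
          (fun _ => ENNReal.ofReal (halfChord x)) t := by
      intro t
      simp [indicator, hx1]
    simp_rw [e3]
    rw [lintegral_indicator hm, Measure.restrict_restrict hm, setLIntegral_const]
  · have hx2 : 1 < |x| := by
      refine lt_of_le_of_ne (not_lt.1 hx1) fun h => ?_
      rcases eq_or_eq_neg_of_abs_eq h.symm with h | h
      · exact hx.1 h
      · exact hx.2 h
    have e1 : Prod.mk x ⁻¹' {p : ℝ × ℝ | p ∈ unitDisc ∧ V p ∈ Icc a b} = ∅ := by
      ext y
      simp only [mem_preimage, mem_ofPred_eq, unitDisc, mem_empty_iff_false, iff_false, not_and]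
      intro h
      exfalso
      nlinarith [sq_abs x, sq_nonneg y]
    rw [e1]
    simp [indicator, hx1]

/-- Horizontal slices suffice here. Values near `s` need `|x| ≥ 3/10 - 2/100 = 7/25`, hence `|y| ≤
24/25`, and each slice has length at most `100/99 * (b - a)`. The product `2 * (24/25) * (100/99)`
is below 39/20, and so below the central height 197/100. -/
theorem densityAt_discDistribution_le {V : ℝ × ℝ → ℝ} (hV : Continuous V)
    (h1 : ∀ p ∈ unitDisc, |V p - p.1| ≤ 1 / 100)
    (h2 : ∀ x x' y, (x, y) ∈ unitDisc → (x', y) ∈ unitDisc → x ≤ x' →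
      99 / 100 * (x' - x) ≤ V (x', y) - V (x, y)) {s : ℝ} (hs : 3 / 10 ≤ |s|) :
    densityAt (discDistribution V) s ≤ ENNReal.ofReal (39 / 20) := by
  refine densityAt_le_of_forall_le (δ := 1 / 100) (by norm_num) fun a b ha hab hb => ?_
  rw [discDistribution_Icc hV, Measure.volume_eq_prod,
    Measure.prod_apply_symm (measurableSet_disc_preimage hV a b)]
  have h3 : ∀ y, volume ((fun x => (x, y)) ⁻¹' {p : ℝ × ℝ | p ∈ unitDisc ∧ V p ∈ Icc a b}) ≤
      (Icc (-(24 / 25)) (24 / 25)).indicator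
        (fun _ => ENNReal.ofReal (100 / 99 * (b - a))) y := by
    intro y
    by_cases hy : y ∈ Icc (-(24 / 25) : ℝ) (24 / 25)
    · rw [indicator_of_mem hy]
      refine (Real.volume_le_diam _).trans (Metric.ediam_le fun x hx x' hx' => ?_)
      rw [edist_dist]
      refine ENNReal.ofReal_le_ofReal ?_
      simp only [mem_preimage, mem_ofPred_eq] at hx hx'
      rw [Real.dist_eq]
      rcases le_total x x' with h | h
      · have := h2 x x' y hx.1 hx'.1 h
        rw [abs_of_nonpos (by linarith)]
        linarith [hx.2.1, hx'.2.2]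
      · have := h2 x' x y hx'.1 hx.1 h
        rw [abs_of_nonneg (by linarith)]
        linarith [hx'.2.1, hx.2.2]
    · have e1 : (fun x => (x, y)) ⁻¹' {p : ℝ × ℝ | p ∈ unitDisc ∧ V p ∈ Icc a b} = ∅ := by
        ext x
        simp only [mem_preimage, mem_ofPred_eq, mem_empty_iff_false, iff_false, not_and]
        intro hx hVx
        have h4 := abs_le.1 (h1 _ hx)
        simp only [unitDisc, mem_ofPred_eq] at hx h4
        refine hy (abs_le.1 (abs_le_of_sq_le_sq ?_ (by norm_num)))
        have h5 : 7 / 25 ≤ |x| := by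
          rcases le_abs'.1 hs with h | h
          · rw [abs_of_neg (by linarith [hVx.1, hVx.2])]; linarith [hVx.1, hVx.2]
          · rw [abs_of_pos (by linarith [hVx.1, hVx.2])]; linarith [hVx.1, hVx.2]
        nlinarith [sq_abs x]
      rw [e1]; simp
  refine (lintegral_mono h3).trans ?_
  rw [lintegral_indicator measurableSet_Icc, setLIntegral_const, Real.volume_Icc,
    ← ENNReal.ofReal_mul (by linarith), ← ENNReal.ofReal_mul (by norm_num)]
  refine ENNReal.ofReal_le_ofReal ?_
  nlinarith

theorem discDistribution_compl_Icc {V : ℝ × ℝ → ℝ} (hV : Continuous V)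
    (h1 : ∀ p ∈ unitDisc, |V p - p.1| ≤ 1 / 100) :
    discDistribution V (Icc (-2) 2)ᶜ = 0 := by
  rw [discDistribution, Measure.map_apply hV.measurable measurableSet_Icc.compl,
    Measure.restrict_apply (hV.measurable measurableSet_Icc.compl)]
  convert measure_empty (μ := (volume : Measure (ℝ × ℝ)))
  ext ⟨x, y⟩
  simp only [mem_inter_iff, mem_preimage, mem_compl_iff, mem_empty_iff_false, iff_false, not_and]
  refine fun h hp => h ?_
  have h2 := abs_le.1 (h1 _ hp)
  simp only [unitDisc, mem_ofPred_eq] at h2 hp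
  constructor <;> nlinarith [sq_nonneg y]

/-! ### Uniqueness and location of the mode -/

/-- The density is the average over `t` of strongly concave slice densities. The function `-l`
approximates their slopes at `s₀`; as `l` integrates to zero, `s₀` is nearly critical and the
maximum is close to it. -/
theorem existsUnique_isModeOf_discDistribution {V : ℝ × ℝ → ℝ} (hV : Continuous V) {ε : ℝ}
    (h1 : ∀ p ∈ unitDisc, |V p - p.1| ≤ 1 / 100)
    (h2 : ∀ x x' y, (x, y) ∈ unitDisc → (x', y) ∈ unitDisc → x ≤ x' →
      99 / 100 * (x' - x) ≤ V (x', y) - V (x, y))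
    {P P1 P2 : ℝ → ℝ → ℝ}
    (hN : ∀ t, |t| ≤ 1 →
      NearlyLinear (fun x => V (x, t * halfChord x)) (P t) (P1 t) (P2 t) ε)
    {s₀ η : ℝ} (hs₀ : |s₀| < 2 / 5) {l : ℝ → ℝ} (hl : Continuous l)
    (hl0 : ∫ t in Icc (-1 : ℝ) 1, l t = 0)
    (hη : ∀ t, |t| ≤ 1 → ∀ x, |x| ≤ 1 / 2 → |x| ≤ 2 * (|s₀| + ε) →
      |(s₀ - V (0, t * halfChord 0)) + P1 t x - l t| ≤ η) :
    ∃ m, (∀ z, IsModeOf (discDistribution V) z ↔ z = m) ∧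
      |m - s₀| ≤ 4 * (20 * (|s₀| + ε) ^ 2 + η) := by
  have key : ∀ t, ∃ φ q : ℝ → ℝ, |t| ≤ 1 →
      (∀ s δ a b, |s| < 2 / 5 → |a| < 2 / 5 → |b| < 2 / 5 → a ≤ b → s - δ < a → b < s + δ →
        ∃ r, 0 ≤ r ∧ |r - (b - a) * φ s| ≤ δ * (b - a) ∧
          sliceMass V a b t = ENNReal.ofReal r) ∧
      (∀ s s', |s| < 2 / 5 → |s'| < 2 / 5 →
        φ s' ≤ φ s + q s * (s' - s) - 1 / 4 * (s' - s) ^ 2) ∧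
      197 / 200 ≤ φ 0 ∧ (∀ s, |s| < 2 / 5 → 0 ≤ φ s ∧ φ s ≤ 2) ∧
      ∀ s, |s| < 2 / 5 → ∃ x, |x| ≤ 1 / 2 ∧ |x| ≤ 2 * (|s| + ε) ∧
        |q s + (s - V (0, t * halfChord 0)) + P1 t x| ≤ 20 * (|s| + ε) ^ 2 := by
    intro t
    by_cases ht : |t| ≤ 1
    · obtain ⟨φ, q, H⟩ := (hN t ht).exists_density
      exact ⟨φ, q, fun _ => H⟩
    · exact ⟨0, 0, fun h => absurd h ht⟩
  choose φ q H using key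
  set μ : Measure ℝ := volume.restrict (Icc (-1) 1) with hμ
  have hμ1 : μ.real univ = 2 := by
    simp [hμ, measureReal_def]; norm_num
  have hmem : ∀ᵐ t ∂μ, |t| ≤ 1 := by
    filter_upwards [ae_restrict_mem measurableSet_Icc] with t ht using abs_le.2 ht
  have hmeas : ∀ s, |s| < 2 / 5 → AEStronglyMeasurable (fun t => φ t s) μ := by
    intro s hs
    refine AEMeasurable.aestronglyMeasurable ?_
    have hu := tendsto_one_div_add_atTop_nhds_zero_nat (𝕜 := ℝ)
    -- The densities `φ t` were chosen separately for each `t`; measurability in `t` is recovered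
    -- from difference quotients of the measurable slice masses.
    refine aemeasurable_of_tendsto_metrizable_ae' (f := fun (n : ℕ) t =>
      (sliceMass V s (s + 1 / ((n : ℝ) + 1)) t).toReal / (1 / ((n : ℝ) + 1)))
      (fun n => ((measurable_sliceMass hV _ _).ennreal_toReal.div_const _).aemeasurable) ?_
    filter_upwards [hmem] with t ht
    have hev : ∀ᶠ n : ℕ in atTop, 1 / ((n : ℝ) + 1) < 2 / 5 - |s| :=
      hu.eventually (gt_mem_nhds (by linarith))
    rw [tendsto_iff_dist_tendsto_zero]
    refine squeeze_zero' (Eventually.of_forall fun _ => dist_nonneg)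
      (g := fun n : ℕ => 2 * (1 / ((n : ℝ) + 1))) ?_ (by simpa using hu.const_mul 2)
    filter_upwards [hev] with n hn
    have hpos : (0 : ℝ) < 1 / ((n : ℝ) + 1) := by positivity
    generalize 1 / ((n : ℝ) + 1) = d at hn hpos
    have hs' := abs_le.1 (le_refl |s|)
    obtain ⟨r, hr0, hr, e⟩ := (H t ht).1 s (2 * d) s (s + d) hs hs
      (by rw [abs_lt]; constructor <;> linarith) (by linarith) (by linarith) (by linarith)
    rw [e, ENNReal.toReal_ofReal hr0, Real.dist_eq]
    rw [add_sub_cancel_left] at hr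
    have e2 : r / d - φ t s = (r - d * φ t s) / d := by field_simp
    rw [e2, abs_div, abs_of_pos hpos, div_le_iff₀ hpos]
    exact hr
  have hint : ∀ s, |s| < 2 / 5 → Integrable (fun t => φ t s) μ := fun s hs =>
    Integrable.of_bound (hmeas s hs) 2 (by
      filter_upwards [hmem] with t ht
      have := (H t ht).2.2.2.1 s hs
      rw [Real.norm_eq_abs, abs_of_nonneg this.1]; exact this.2)
  set f : ℝ → ℝ := fun s => ∫ t, φ t s ∂μ with hf
  have hcenter : ∀ s, |s| < 2 / 5 → densityAt (discDistribution V) s = ENNReal.ofReal (f s) := by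
    intro s hs
    refine densityAt_eq_of_approx fun e he => ?_
    have hpos : 0 < min (2 / 5 - |s|) (e / 2) := lt_min (by linarith) (by linarith)
    refine ⟨_, hpos, fun a b ha hab hb => ?_⟩
    have hs' := abs_le.1 (le_refl |s|)
    have hd1 := min_le_left (2 / 5 - |s|) (e / 2)
    have hd2 := min_le_right (2 / 5 - |s|) (e / 2)
    have ha' : |a| < 2 / 5 := by rw [abs_lt]; constructor <;> linarith
    have hb' : |b| < 2 / 5 := by rw [abs_lt]; constructor <;> linarith
    have hm := measurable_sliceMass hV a b
    have hR : ∀ t, |t| ≤ 1 → sliceMass V a b t < ⊤ ∧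
        |(sliceMass V a b t).toReal - (b - a) * φ t s| ≤ e / 2 * (b - a) := by
      intro t ht
      obtain ⟨r, hr0, hr, e1⟩ := (H t ht).1 s _ a b hs ha' hb' hab.le ha hb
      rw [e1, ENNReal.toReal_ofReal hr0]
      exact ⟨by simp, hr.trans (mul_le_mul_of_nonneg_right hd2 (by linarith))⟩
    have e1 : (discDistribution V).real (Icc a b) = ∫ t, (sliceMass V a b t).toReal ∂μ := by
      rw [integral_toReal hm.aemeasurable (by filter_upwards [hmem] with t ht using (hR t ht).1),
        measureReal_def, discDistribution_Icc_eq_lintegral hV]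
    have hi := (hint s hs).const_mul (b - a)
    have hiD : Integrable (fun t => (sliceMass V a b t).toReal - (b - a) * φ t s) μ :=
      Integrable.of_bound (hm.ennreal_toReal.aestronglyMeasurable.sub hi.aestronglyMeasurable)
        (e / 2 * (b - a)) (by filter_upwards [hmem] with t ht using (hR t ht).2)
    have hiM : Integrable (fun t => (sliceMass V a b t).toReal) μ := by
      refine (hiD.add hi).congr (Eventually.of_forall fun t => ?_)
      simp
    rw [e1, hf, ← integral_const_mul, ← integral_sub hiM hi]
    have := norm_integral_le_of_norm_le_const (μ := μ)
      (show ∀ᵐ t ∂μ, ‖(sliceMass V a b t).toReal - (b - a) * φ t s‖ ≤ e / 2 * (b - a) by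
        filter_upwards [hmem] with t ht using (hR t ht).2)
    rw [hμ1] at this
    rw [← Real.norm_eq_abs]
    linarith
  have hf0 : 197 / 100 ≤ f 0 := by
    have h0 : |(0 : ℝ)| < 2 / 5 := by norm_num
    have := integral_mono_ae (integrable_const (197 / 200 : ℝ)) (hint 0 h0)
      (by filter_upwards [hmem] with t ht using (H t ht).2.2.1)
    rw [integral_const, hμ1] at this
    refine le_trans (le_of_eq ?_) this
    norm_num
  have hfnn : ∀ s, |s| < 2 / 5 → 0 ≤ f s := fun s hs =>
    integral_nonneg_of_ae (by filter_upwards [hmem] with t ht using ((H t ht).2.2.2.1 s hs).1)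
  have hmode : ∀ z, IsModeOf (discDistribution V) z →
      |z| < 2 / 5 ∧ ∀ s, |s| < 2 / 5 → f s ≤ f z := by
    intro z hz
    have hz1 : |z| < 2 / 5 := by
      by_contra! hcon
      have h3 := (hz 0).trans (densityAt_discDistribution_le hV h1 h2 (s := z) (by linarith))
      rw [hcenter 0 (by norm_num), ENNReal.ofReal_le_ofReal_iff (by norm_num)] at h3
      linarith
    refine ⟨hz1, fun s hs => ?_⟩
    have h3 := hz s
    rwa [hcenter s hs, hcenter z hz1, ENNReal.ofReal_le_ofReal_iff (hfnn z hz1)] at h3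
  obtain ⟨m, -, hm⟩ := exists_isModeOf (by norm_num) (discDistribution_compl_Icc hV h1)
  obtain ⟨hmJ, hmax⟩ := hmode m hm
  refine ⟨m, fun z => ⟨fun hz => ?_, fun hz => hz ▸ hm⟩, ?_⟩
  · obtain ⟨hzJ, hzmax⟩ := hmode z hz
    have hmid : |(z + m) / 2| < 2 / 5 := by
      rw [abs_lt] at *; constructor <;> linarith
    -- The concavity bound at the midpoint, applied to both ends, cancels the linear terms; two
    -- distinct maxima would contradict it.
    have hle : f z + f m ≤ 2 * f ((z + m) / 2) - 1 / 4 * (z - m) ^ 2 := by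
      have h3 : ∫ t, φ t z + φ t m ∂μ ≤
          ∫ t, (2 * φ t ((z + m) / 2) - 1 / 8 * (z - m) ^ 2) ∂μ := by
        refine integral_mono_ae ((hint z hzJ).add (hint m hmJ))
          (((hint _ hmid).const_mul 2).sub (integrable_const _)) ?_
        filter_upwards [hmem] with t ht
        have h4 := (H t ht).2.1 _ z hmid hzJ
        have h5 := (H t ht).2.1 _ m hmid hmJ
        nlinarith
      rw [integral_add (hint z hzJ) (hint m hmJ),
        integral_sub ((hint _ hmid).const_mul 2) (integrable_const _), integral_const_mul,
        integral_const, hμ1, smul_eq_mul] at h3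
      simp only [hf]
      linarith
    have h3 := hzmax _ hmid
    have h4 := hmax _ hmid
    have h5 : (z - m) ^ 2 ≤ 0 := by linarith
    have h6 := pow_eq_zero_iff (two_ne_zero) |>.1 (le_antisymm h5 (sq_nonneg _))
    linarith
  · set E := 20 * (|s₀| + ε) ^ 2 + η with hE
    -- Replacing the slope at `s₀` by `-l t` costs at most `E * |m - s₀|`, and the integral of `l`
    -- drops out. Maximality of `f m` then gives `|m - s₀|² ≤ 4E|m - s₀|`.
    have hloc : f m ≤ f s₀ + 2 * (E * |m - s₀| - 1 / 4 * (m - s₀) ^ 2) := by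
      have hl' : Integrable l μ := hl.integrableOn_Icc
      have h3 : ∫ t, φ t m ∂μ ≤
          ∫ t, ((φ t s₀ - l t * (m - s₀)) + (E * |m - s₀| - 1 / 4 * (m - s₀) ^ 2)) ∂μ := by
        refine integral_mono_ae (hint m hmJ)
          (((hint _ hs₀).sub (hl'.mul_const _)).add (integrable_const _)) ?_
        filter_upwards [hmem] with t ht
        have h4 := (H t ht).2.1 s₀ m hs₀ hmJ
        obtain ⟨x, hx, hx', hq⟩ := (H t ht).2.2.2.2 s₀ hs₀
        have h5 := hη t ht x hx hx'
        have h6 : |q t s₀ + l t| ≤ E := by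
          have e1 : q t s₀ + l t = (q t s₀ + (s₀ - V (0, t * halfChord 0)) + P1 t x) -
            ((s₀ - V (0, t * halfChord 0)) + P1 t x - l t) := by ring
          rw [e1]
          exact (abs_sub _ _).trans (add_le_add hq h5)
        have h7 : (q t s₀ + l t) * (m - s₀) ≤ E * |m - s₀| := by
          refine (le_abs_self _).trans ?_
          rw [abs_mul]
          exact mul_le_mul_of_nonneg_right h6 (abs_nonneg _)
        linarith
      have hi : Integrable (fun t => φ t s₀ - l t * (m - s₀)) μ :=
        (hint _ hs₀).sub (hl'.mul_const _)
      rw [integral_add hi (integrable_const _),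
        integral_sub (hint _ hs₀) (hl'.mul_const _), integral_mul_const, hl0,
        integral_const, hμ1, smul_eq_mul] at h3
      simp only [hf]
      linarith
    have h3 := hmax _ hs₀
    have h4 : |m - s₀| * |m - s₀| ≤ 4 * E * |m - s₀| := by
      rw [abs_mul_abs_self]; nlinarith
    rcases (abs_nonneg (m - s₀)).eq_or_lt with h5 | h5
    · rw [← h5]
      have := (abs_nonneg _).trans (hη 0 (by simp) 0 (by simp)
        (by
          have := (hN 0 (by simp)).nonneg
          rw [abs_zero]; positivity))
      positivity
    · exact le_of_mul_le_mul_right h4 h5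

/-! ### Orthonormal frames and rescaling of the disc -/

section Frame

variable {η ξ : Plane}

theorem norm_frame_sq (hη : ‖η‖ = 1) (hξ : ‖ξ‖ = 1) (hηξ : inner ℝ η ξ = 0) (x y : ℝ) :
    ‖x • η + y • ξ‖ ^ 2 = x ^ 2 + y ^ 2 := by
  rw [norm_add_sq_real, norm_smul, norm_smul, inner_smul_left, inner_smul_right, hη, hξ, hηξ]
  simp

theorem exists_orthonormalBasis_frame (hη : ‖η‖ = 1) (hξ : ‖ξ‖ = 1) (hηξ : inner ℝ η ξ = 0) :
    ∃ b : OrthonormalBasis (Fin 2) ℝ Plane, b 0 = η ∧ b 1 = ξ := by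
  have ho : Orthonormal ℝ ![η, ξ] := by
    constructor
    · intro i; fin_cases i <;> simp [hη, hξ]
    · intro i j hij
      fin_cases i <;> fin_cases j <;> simp_all [real_inner_comm]
  have hcard : Fintype.card (Fin 2) = Module.finrank ℝ Plane := by simp
  let b := basisOfOrthonormalOfCardEqFinrank ho hcard
  have hb : ⇑b = ![η, ξ] := coe_basisOfOrthonormalOfCardEqFinrank ho hcard
  refine ⟨b.toOrthonormalBasis (by rw [hb]; exact ho), ?_, ?_⟩ <;> simp [hb]

theorem measurePreserving_frame (hη : ‖η‖ = 1) (hξ : ‖ξ‖ = 1) (hηξ : inner ℝ η ξ = 0) :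
    MeasurePreserving (fun p : ℝ × ℝ => p.1 • η + p.2 • ξ) := by
  obtain ⟨b, rfl, rfl⟩ := exists_orthonormalBasis_frame hη hξ hηξ
  have h := (b.measurePreserving_repr_symm.comp (PiLp.volume_preserving_toLp (Fin 2))).comp
    (volume_preserving_finTwoArrow ℝ).symm
  have e : (fun p : ℝ × ℝ => p.1 • b 0 + p.2 • b 1) =
      (b.repr.symm ∘ WithLp.toLp 2) ∘ MeasurableEquiv.finTwoArrow.symm := by
    ext1 p
    change _ = b.repr.symm (WithLp.toLp 2 ![p.1, p.2])
    rw [← b.sum_repr_symm, Fin.sum_univ_two]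
    rfl
  rw [e]
  exact h

/-- The frame preserves area, translation does too, and the dilation by `ρ` contributes the factor
`ρ²`. -/
theorem valueDistribution_Icc_eq {u : Plane → ℝ} (hu : Continuous u) (hη : ‖η‖ = 1)
    (hξ : ‖ξ‖ = 1) (hηξ : inner ℝ η ξ = 0) (x₀ : Plane) {ρ g : ℝ} (hρ : 0 < ρ) (hg : 0 < g)
    (a b : ℝ) :
    valueDistribution u x₀ ρ (Icc (u x₀ + ρ * g * a) (u x₀ + ρ * g * b)) =
      ENNReal.ofReal (ρ ^ 2) * discDistribution
        (fun p => (u (x₀ + ρ • (p.1 • η + p.2 • ξ)) - u x₀) / (ρ * g)) (Icc a b) := by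
  have hρg : 0 < ρ * g := mul_pos hρ hg
  set A : Set Plane := u ⁻¹' Icc (u x₀ + ρ * g * a) (u x₀ + ρ * g * b) ∩ Metric.closedBall x₀ ρ
    with hA
  have hAm : MeasurableSet A :=
    (hu.measurable measurableSet_Icc).inter Metric.isClosed_closedBall.measurableSet
  have hV : Continuous fun p : ℝ × ℝ =>
      (u (x₀ + ρ • (p.1 • η + p.2 • ξ)) - u x₀) / (ρ * g) := by fun_prop
  have hA1 : MeasurableSet ((fun v => x₀ + v) ⁻¹' A) := hAm.preimage (by fun_prop)
  have hA2 : MeasurableSet ((fun v : Plane => ρ • v) ⁻¹' ((fun v => x₀ + v) ⁻¹' A)) :=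
    hA1.preimage (by fun_prop)
  have e1 : {p : ℝ × ℝ | p ∈ unitDisc ∧
      (u (x₀ + ρ • (p.1 • η + p.2 • ξ)) - u x₀) / (ρ * g) ∈ Icc a b} =
      (fun p : ℝ × ℝ => p.1 • η + p.2 • ξ) ⁻¹'
        ((fun v : Plane => ρ • v) ⁻¹' ((fun v => x₀ + v) ⁻¹' A)) := by
    ext p
    have h1 : p ∈ unitDisc ↔ ‖p.1 • η + p.2 • ξ‖ ≤ 1 := by
      rw [← sq_le_one_iff₀ (norm_nonneg _), norm_frame_sq hη hξ hηξ]; rfl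
    simp only [hA, mem_preimage, mem_ofPred_eq, mem_inter_iff, mem_Icc, h1,
      le_div_iff₀ hρg, div_le_iff₀ hρg, mem_closedBall_iff_norm, add_sub_cancel_left, norm_smul,
      Real.norm_eq_abs, abs_of_pos hρ]
    rw [mul_le_iff_le_one_right hρ, and_comm]
    refine and_congr_left fun _ => ?_
    constructor <;> rintro ⟨h2, h3⟩ <;> constructor <;> linarith
  rw [valueDistribution, Measure.map_apply hu.measurable measurableSet_Icc,
    Measure.restrict_apply (hu.measurable measurableSet_Icc), discDistribution_Icc hV, e1,
    (measurePreserving_frame hη hξ hηξ).measure_preimage hA2.nullMeasurableSet,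
    Measure.addHaar_preimage_smul volume hρ.ne', measure_preimage_add, ← mul_assoc,
    ← ENNReal.ofReal_mul (by positivity)]
  have e2 : ρ ^ 2 * |(ρ ^ Module.finrank ℝ Plane)⁻¹| = 1 := by
    have : Module.finrank ℝ Plane = 2 := by simp
    rw [this, abs_of_pos (by positivity)]
    field_simp
  rw [e2]
  simp [hA]

end Frame

/-! ### Taylor bounds near a point -/

section Taylor

variable {E F : Type*} [NormedAddCommGroup E] [NormedSpace ℝ E] [NormedAddCommGroup F]
  [NormedSpace ℝ F]

omit [NormedSpace ℝ E] [NormedSpace ℝ F] in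
theorem exists_norm_le_unitBall [ProperSpace E] {f : E → F} (hf : Continuous f) (x₀ : E) :
    ∃ C, 0 ≤ C ∧ ∀ p, ‖p - x₀‖ ≤ 1 → ‖f p‖ ≤ C := by
  obtain ⟨C, hC⟩ := (isCompact_closedBall x₀ 1).exists_bound_of_continuousOn hf.continuousOn
  exact ⟨C, (norm_nonneg _).trans (hC x₀ (by simp)),
    fun p hp => hC p (mem_closedBall_iff_norm.2 hp)⟩

theorem norm_sub_sub_le_mul_norm {f : E → F} (hf : Differentiable ℝ f) {x₀ p : E} {K : ℝ}
    {φ : E →L[ℝ] F} (hK : ∀ z, ‖z - x₀‖ ≤ ‖p - x₀‖ → ‖fderiv ℝ f z - φ‖ ≤ K) :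
    ‖f p - f x₀ - φ (p - x₀)‖ ≤ K * ‖p - x₀‖ :=
  (convex_closedBall x₀ ‖p - x₀‖).norm_image_sub_le_of_norm_hasFDerivWithin_le'
    (fun z _ => (hf z).hasFDerivAt.hasFDerivWithinAt)
    (fun z hz => hK z (mem_closedBall_iff_norm.1 hz)) (by simp) (mem_closedBall_iff_norm.2 le_rfl)

theorem exists_norm_sub_le_unitBall [ProperSpace E] {f : E → F} (hf : ContDiff ℝ ∞ f) (x₀ : E) :
    ∃ C, 0 ≤ C ∧ ∀ p, ‖p - x₀‖ ≤ 1 → ‖f p - f x₀‖ ≤ C * ‖p - x₀‖ := by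
  obtain ⟨C, hC0, hC⟩ := exists_norm_le_unitBall (hf.continuous_fderiv (by simp)) x₀
  refine ⟨C, hC0, fun p hp => ?_⟩
  simpa using norm_sub_sub_le_mul_norm (hf.differentiable (by simp)) (φ := 0)
    (x₀ := x₀) (p := p) fun z hz => by simpa using hC z (hz.trans hp)

theorem exists_norm_sub_sub_le_unitBall [ProperSpace E] {f : E → F} (hf : ContDiff ℝ ∞ f)
    (x₀ : E) : ∃ C, 0 ≤ C ∧ ∀ p, ‖p - x₀‖ ≤ 1 →
      ‖f p - f x₀ - fderiv ℝ f x₀ (p - x₀)‖ ≤ C * ‖p - x₀‖ ^ 2 := by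
  obtain ⟨C, hC0, hC⟩ := exists_norm_sub_le_unitBall (hf.fderiv_right (m := ∞) (by simp)) x₀
  refine ⟨C, hC0, fun p hp => ?_⟩
  rw [pow_two, ← mul_assoc]
  exact norm_sub_sub_le_mul_norm (hf.differentiable (by simp)) fun z hz =>
    (hC z (hz.trans hp)).trans (mul_le_mul_of_nonneg_left hz hC0)

/-- Bounds for a function and its first three derivatives near `x₀`. -/
structure TaylorBounds (u : E → ℝ) (x₀ : E) (C : ℝ) : Prop where
  nonneg : 0 ≤ C
  zero_sub_sub : ∀ p, ‖p - x₀‖ ≤ 1 →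
    |u p - u x₀ - fderiv ℝ u x₀ (p - x₀)| ≤ C * ‖p - x₀‖ ^ 2
  one_sub : ∀ p, ‖p - x₀‖ ≤ 1 → ‖fderiv ℝ u p - fderiv ℝ u x₀‖ ≤ C * ‖p - x₀‖
  one_sub_sub : ∀ p, ‖p - x₀‖ ≤ 1 →
    ‖fderiv ℝ u p - fderiv ℝ u x₀ - fderiv ℝ (fderiv ℝ u) x₀ (p - x₀)‖ ≤ C * ‖p - x₀‖ ^ 2
  two : ∀ p, ‖p - x₀‖ ≤ 1 → ‖fderiv ℝ (fderiv ℝ u) p‖ ≤ C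
  two_sub : ∀ p, ‖p - x₀‖ ≤ 1 →
    ‖fderiv ℝ (fderiv ℝ u) p - fderiv ℝ (fderiv ℝ u) x₀‖ ≤ C * ‖p - x₀‖
  three : ∀ p v, ‖p - x₀‖ ≤ 1 → ‖fderiv ℝ (fderiv ℝ (fderiv ℝ u)) p v‖ ≤ C * ‖v‖

theorem exists_taylorBounds [ProperSpace E] {u : E → ℝ} (hu : ContDiff ℝ ∞ u) (x₀ : E) :
    ∃ C, TaylorBounds u x₀ C := by
  have h1 : ContDiff ℝ ∞ (fderiv ℝ u) := hu.fderiv_right (by simp)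
  have h2 : ContDiff ℝ ∞ (fderiv ℝ (fderiv ℝ u)) := h1.fderiv_right (by simp)
  obtain ⟨A, hA0, hA⟩ := exists_norm_sub_sub_le_unitBall hu x₀
  obtain ⟨B, hB0, hB⟩ := exists_norm_sub_le_unitBall h1 x₀
  obtain ⟨C, hC0, hC⟩ := exists_norm_sub_sub_le_unitBall h1 x₀
  obtain ⟨D, hD0, hD⟩ := exists_norm_le_unitBall h2.continuous x₀
  obtain ⟨G, hG0, hG⟩ := exists_norm_sub_le_unitBall h2 x₀
  obtain ⟨K, hK0, hK⟩ := exists_norm_le_unitBall (h2.continuous_fderiv (by simp)) x₀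
  refine ⟨A + B + C + D + G + K, by positivity, fun p hp => (hA p hp).trans ?_,
    fun p hp => (hB p hp).trans ?_, fun p hp => (hC p hp).trans ?_, fun p hp => (hD p hp).trans ?_,
    fun p hp => (hG p hp).trans ?_,
    fun p v hp => (ContinuousLinearMap.le_of_opNorm_le _ (hK p hp) v).trans ?_⟩
  any_goals refine mul_le_mul_of_nonneg_right ?_ (by positivity)
  all_goals linarith

theorem TaylorBounds.abs_sub_sub_sq_le {u : E → ℝ} (hu : ContDiff ℝ ∞ u) {x₀ ξ : E} {C : ℝ}
    (h : TaylorBounds u x₀ C) (hξ : ‖ξ‖ = 1) (hξ0 : fderiv ℝ u x₀ ξ = 0) {y : ℝ} (hy : |y| ≤ 1) :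
    |u (x₀ + y • ξ) - u x₀ - y ^ 2 / 2 * fderiv ℝ (fderiv ℝ u) x₀ ξ ξ| ≤ C * |y| ^ 3 := by
  have hd : ∀ z ∈ {z : ℝ | |z| ≤ |y|}, HasDerivAt
      (fun z : ℝ => u (x₀ + z • ξ) - z ^ 2 / 2 * fderiv ℝ (fderiv ℝ u) x₀ ξ ξ)
      (fderiv ℝ u (x₀ + z • ξ) ξ - z * fderiv ℝ (fderiv ℝ u) x₀ ξ ξ) z := by
    intro z _
    have e1 : HasDerivAt (fun z : ℝ => x₀ + z • ξ) ξ z := by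
      simpa using ((hasDerivAt_id z).smul_const ξ).const_add x₀
    have e2 := ((hu.differentiable (by simp)) (x₀ + z • ξ)).hasFDerivAt.comp_hasDerivAt z e1
    have e3 : HasDerivAt (fun z : ℝ => z ^ 2 / 2) z z := by
      refine ((hasDerivAt_pow 2 z).div_const 2).congr_deriv ?_
      simp
    exact e2.sub (e3.mul_const _)
  obtain ⟨ζ, hζ, -, e⟩ := exists_hasDerivAt_sub_eq_mul (ordConnected_abs_le |y|) hd
    (x := 0) (y := y) (by simp) (by simp)
  have hζ1 : ‖x₀ + ζ • ξ - x₀‖ = |ζ| := by simp [norm_smul, hξ]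
  have hb := h.one_sub_sub (x₀ + ζ • ξ) (by rw [hζ1]; exact le_trans hζ hy)
  rw [hζ1] at hb
  have hb2 := (ContinuousLinearMap.le_of_opNorm_le _ hb ξ)
  rw [hξ, mul_one] at hb2
  simp only [add_sub_cancel_left, map_smul, sub_apply,
    smul_apply, hξ0, sub_zero, smul_eq_mul, Real.norm_eq_abs] at hb2
  have e' : u (x₀ + y • ξ) - u x₀ - y ^ 2 / 2 * fderiv ℝ (fderiv ℝ u) x₀ ξ ξ =
      (fderiv ℝ u (x₀ + ζ • ξ) ξ - ζ * fderiv ℝ (fderiv ℝ u) x₀ ξ ξ) * y := by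
    rw [sub_zero] at e
    rw [← e]
    simp
    ring
  rw [e', abs_mul]
  have h3 : |ζ| ^ 2 ≤ |y| ^ 2 := pow_le_pow_left₀ (abs_nonneg _) hζ 2
  calc _ ≤ (C * |y| ^ 2) * |y| :=
        mul_le_mul_of_nonneg_right (hb2.trans (mul_le_mul_of_nonneg_left h3 h.nonneg))
          (abs_nonneg _)
    _ = C * |y| ^ 3 := by ring

end Taylor

/-! ### The blown-up function along the curves -/

/-- An orthonormal frame whose first vector points in the direction of a nonzero gradient of
length `g`, with bounds for the derivatives of the function. -/
structure GradientFrame (u : Plane → ℝ) (x₀ η ξ : Plane) (g C : ℝ) : Prop where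
  contDiff : ContDiff ℝ ∞ u
  norm_fst : ‖η‖ = 1
  norm_snd : ‖ξ‖ = 1
  inner_eq : inner ℝ η ξ = 0
  pos : 0 < g
  fderiv_fst : fderiv ℝ u x₀ η = g
  fderiv_snd : fderiv ℝ u x₀ ξ = 0
  bounds : TaylorBounds u x₀ C

/-- The function in the coordinates of a frame, blown up at `x₀`. -/
noncomputable def blowUp (u : Plane → ℝ) (x₀ η ξ : Plane) (g ρ : ℝ) (p : ℝ × ℝ) : ℝ :=
  (u (x₀ + ρ • (p.1 • η + p.2 • ξ)) - u x₀) / (ρ * g)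

/-- The curve `x ↦ (x, t √(1 - x²))` in the coordinates of a frame. -/
noncomputable def curve (η ξ : Plane) (t x : ℝ) : Plane := x • η + (t * halfChord x) • ξ

/-- The velocity of `curve`. -/
noncomputable def curve1 (η ξ : Plane) (t x : ℝ) : Plane := η + (t * (-x / halfChord x)) • ξ

/-- The acceleration of `curve`. -/
noncomputable def curve2 (ξ : Plane) (t x : ℝ) : Plane := (t * (-1 / halfChord x ^ 3)) • ξ

/-- The third derivative of `curve`. -/
noncomputable def curve3 (ξ : Plane) (t x : ℝ) : Plane := (t * (-3 * x / halfChord x ^ 5)) • ξ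

/-- The first derivative of `blowUp` along `curve`. -/
noncomputable def slope1 (u : Plane → ℝ) (x₀ η ξ : Plane) (g ρ t x : ℝ) : ℝ :=
  fderiv ℝ u (x₀ + ρ • curve η ξ t x) (curve1 η ξ t x) / g

/-- The second derivative of `blowUp` along `curve`. -/
noncomputable def slope2 (u : Plane → ℝ) (x₀ η ξ : Plane) (g ρ t x : ℝ) : ℝ :=
  (fderiv ℝ (fderiv ℝ u) (x₀ + ρ • curve η ξ t x) (ρ • curve1 η ξ t x) (curve1 η ξ t x) +
    fderiv ℝ u (x₀ + ρ • curve η ξ t x) (curve2 ξ t x)) / g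

/-- The third derivative of `blowUp` along `curve`. -/
noncomputable def slope3 (u : Plane → ℝ) (x₀ η ξ : Plane) (g ρ t x : ℝ) : ℝ :=
  ((fderiv ℝ (fderiv ℝ (fderiv ℝ u)) (x₀ + ρ • curve η ξ t x) (ρ • curve1 η ξ t x)
      (ρ • curve1 η ξ t x) (curve1 η ξ t x) +
    fderiv ℝ (fderiv ℝ u) (x₀ + ρ • curve η ξ t x) (ρ • curve2 ξ t x) (curve1 η ξ t x) +
    fderiv ℝ (fderiv ℝ u) (x₀ + ρ • curve η ξ t x) (ρ • curve1 η ξ t x) (curve2 ξ t x)) +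
    (fderiv ℝ (fderiv ℝ u) (x₀ + ρ • curve η ξ t x) (ρ • curve1 η ξ t x) (curve2 ξ t x) +
    fderiv ℝ u (x₀ + ρ • curve η ξ t x) (curve3 ξ t x))) / g

theorem hasDerivAt_curve (η ξ : Plane) (t : ℝ) {x : ℝ} (hx : |x| < 1) :
    HasDerivAt (curve η ξ t) (curve1 η ξ t x) x := by
  refine (((hasDerivAt_id x).smul_const η).add
    (((hasDerivAt_halfChord hx).const_mul t).smul_const ξ)).congr_deriv ?_
  rw [one_smul, curve1]

theorem hasDerivAt_curve1 (η ξ : Plane) (t : ℝ) {x : ℝ} (hx : |x| < 1) :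
    HasDerivAt (curve1 η ξ t) (curve2 ξ t x) x :=
  (((hasDerivAt_halfChord_deriv hx).const_mul t).smul_const ξ).const_add η

theorem hasDerivAt_curve2 (ξ : Plane) (t : ℝ) {x : ℝ} (hx : |x| < 1) :
    HasDerivAt (curve2 ξ t) (curve3 ξ t x) x :=
  ((hasDerivAt_halfChord_deriv_two hx).const_mul t).smul_const ξ

theorem curve_mem_unitDisc {t x : ℝ} (ht : |t| ≤ 1) (hx : |x| ≤ 1) :
    (x, t * halfChord x) ∈ unitDisc := by
  change x ^ 2 + (t * halfChord x) ^ 2 ≤ 1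
  rw [mul_pow, halfChord_sq hx]
  have h1 : t ^ 2 ≤ 1 := by rw [← sq_abs]; nlinarith [abs_nonneg t]
  have h2 : x ^ 2 ≤ 1 := by rw [← sq_abs]; nlinarith [abs_nonneg x]
  nlinarith

theorem norm_curve1_sub_le {η ξ : Plane} (hξ : ‖ξ‖ = 1) {t x : ℝ} (ht : |t| ≤ 1)
    (hx : |x| ≤ 1 / 2) : ‖curve1 η ξ t x - η‖ ≤ 2 * |x| := by
  have hw := halfChord_ge hx
  rw [curve1, add_sub_cancel_left, norm_smul, hξ, mul_one, Real.norm_eq_abs, abs_mul, abs_div,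
    abs_neg, abs_of_pos (by linarith : 0 < halfChord x)]
  have : |x| / halfChord x ≤ 2 * |x| := by
    rw [div_le_iff₀ (by linarith)]; nlinarith [abs_nonneg x]
  exact (mul_le_of_le_one_left (by positivity) ht).trans this

theorem norm_curve1_le {η ξ : Plane} (hη : ‖η‖ = 1) (hξ : ‖ξ‖ = 1) {t x : ℝ} (ht : |t| ≤ 1)
    (hx : |x| ≤ 1 / 2) : ‖curve1 η ξ t x‖ ≤ 2 := by
  have := norm_curve1_sub_le (η := η) hξ ht hx
  have h2 := norm_sub_norm_le (curve1 η ξ t x) η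
  linarith

theorem abs_one_div_halfChord_cube_le {x : ℝ} (hx : |x| ≤ 1 / 2) :
    |-1 / halfChord x ^ 3| ≤ 2 := by
  have hw := halfChord_ge hx
  have h1 : (43 / 50 : ℝ) ^ 3 ≤ halfChord x ^ 3 := pow_le_pow_left₀ (by norm_num) hw 3
  rw [abs_div, abs_neg, abs_one, abs_of_pos (by positivity), div_le_iff₀ (by positivity)]
  norm_num at h1
  linarith

theorem abs_one_div_halfChord_cube_add_one_le {x : ℝ} (hx : |x| ≤ 1 / 2) :
    |-1 / halfChord x ^ 3 + 1| ≤ 3 * |x| := by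
  have hw := halfChord_ge hx
  have hw1 := halfChord_le_one x
  have hwx := one_sub_sq_le_halfChord (x := x) (by linarith)
  have h1 : (43 / 50 : ℝ) ^ 3 ≤ halfChord x ^ 3 := pow_le_pow_left₀ (by norm_num) hw 3
  have h2 : halfChord x ^ 3 ≤ 1 := pow_le_one₀ (by linarith) hw1
  have h0 : 0 < halfChord x ^ 3 := by positivity
  have e : -1 / halfChord x ^ 3 + 1 = (halfChord x ^ 3 - 1) / halfChord x ^ 3 := by
    field_simp; ring
  rw [e, abs_div, abs_of_pos h0, abs_of_nonpos (by linarith), div_le_iff₀ h0]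
  have h3 : x ^ 2 ≤ 1 / 2 * |x| := by rw [← sq_abs]; nlinarith [abs_nonneg x]
  have h4 : 1 - halfChord x ^ 3 ≤ 3 * (1 - halfChord x) := by
    nlinarith [mul_nonneg (sub_nonneg.2 hw1) (sub_nonneg.2 hw1), sq_nonneg (halfChord x)]
  norm_num at h1
  nlinarith [abs_nonneg x]

theorem norm_curve2_le {ξ : Plane} (hξ : ‖ξ‖ = 1) {t x : ℝ} (ht : |t| ≤ 1)
    (hx : |x| ≤ 1 / 2) : ‖curve2 ξ t x‖ ≤ 2 := by
  rw [curve2, norm_smul, hξ, mul_one, Real.norm_eq_abs, abs_mul]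
  exact (mul_le_of_le_one_left (abs_nonneg _) ht).trans (abs_one_div_halfChord_cube_le hx)

theorem norm_curve3_le {ξ : Plane} (hξ : ‖ξ‖ = 1) {t x : ℝ} (ht : |t| ≤ 1)
    (hx : |x| ≤ 1 / 2) : ‖curve3 ξ t x‖ ≤ 4 := by
  have hw := halfChord_ge hx
  have h1 : (43 / 50 : ℝ) ^ 5 ≤ halfChord x ^ 5 := pow_le_pow_left₀ (by norm_num) hw 5
  rw [curve3, norm_smul, hξ, mul_one, Real.norm_eq_abs, abs_mul]
  refine (mul_le_of_le_one_left (abs_nonneg _) ht).trans ?_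
  rw [abs_div, abs_mul, abs_of_pos (by positivity : 0 < halfChord x ^ 5),
    div_le_iff₀ (by positivity)]
  norm_num at h1 ⊢
  linarith

namespace GradientFrame

variable {u : Plane → ℝ} {x₀ η ξ : Plane} {g C ρ : ℝ}

theorem norm_le_one (h : GradientFrame u x₀ η ξ g C) {p : ℝ × ℝ} (hp : p ∈ unitDisc) :
    ‖p.1 • η + p.2 • ξ‖ ≤ 1 := by
  rw [← sq_le_one_iff₀ (norm_nonneg _), norm_frame_sq h.norm_fst h.norm_snd h.inner_eq]
  exact hp

theorem norm_add_smul_sub_le (hρ : 0 < ρ) {c : Plane} (hc : ‖c‖ ≤ 1) :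
    ‖x₀ + ρ • c - x₀‖ ≤ ρ := by
  rw [add_sub_cancel_left, norm_smul, Real.norm_eq_abs, abs_of_pos hρ]
  exact mul_le_of_le_one_right hρ.le hc

theorem fderiv_frame (h : GradientFrame u x₀ η ξ g C) (x y : ℝ) :
    fderiv ℝ u x₀ (x • η + y • ξ) = g * x := by
  rw [map_add, map_smul, map_smul, h.fderiv_fst, h.fderiv_snd]
  simp [mul_comm]

theorem abs_blowUp_sub_le (h : GradientFrame u x₀ η ξ g C) (hρ : 0 < ρ) (hρ1 : ρ ≤ 1)
    {p : ℝ × ℝ} (hp : p ∈ unitDisc) : |blowUp u x₀ η ξ g ρ p - p.1| ≤ C * ρ / g := by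
  have hk := norm_add_smul_sub_le (x₀ := x₀) hρ (h.norm_le_one hp)
  have h1 := h.bounds.zero_sub_sub _ (hk.trans hρ1)
  rw [add_sub_cancel_left] at hk h1
  rw [map_smul, h.fderiv_frame, smul_eq_mul] at h1
  have hg := h.pos
  have e : blowUp u x₀ η ξ g ρ p - p.1 =
      (u (x₀ + ρ • (p.1 • η + p.2 • ξ)) - u x₀ - ρ * (g * p.1)) / (ρ * g) := by
    rw [blowUp]; field_simp
  rw [e, abs_div, abs_of_pos (mul_pos hρ hg), div_le_div_iff₀ (mul_pos hρ hg) hg]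
  have h2 := pow_le_pow_left₀ (norm_nonneg _) hk 2
  have h3 : |u (x₀ + ρ • (p.1 • η + p.2 • ξ)) - u x₀ - ρ * (g * p.1)| ≤ C * ρ ^ 2 :=
    h1.trans (mul_le_mul_of_nonneg_left h2 h.bounds.nonneg)
  calc _ ≤ C * ρ ^ 2 * g := mul_le_mul_of_nonneg_right h3 hg.le
    _ = C * ρ * (ρ * g) := by ring

theorem abs_fderiv_sub_le (h : GradientFrame u x₀ η ξ g C) (hρ : 0 < ρ) (hρ1 : ρ ≤ 1)
    {c : Plane} (hc : ‖c‖ ≤ 1) (v : Plane) :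
    |fderiv ℝ u (x₀ + ρ • c) v - fderiv ℝ u x₀ v| ≤ C * ρ * ‖v‖ := by
  have hk := norm_add_smul_sub_le (x₀ := x₀) hρ hc
  have h1 := (h.bounds.one_sub _ (hk.trans hρ1)).trans
    (mul_le_mul_of_nonneg_left hk h.bounds.nonneg)
  exact ContinuousLinearMap.le_of_opNorm_le _ h1 v

theorem abs_fderiv_two_le (h : GradientFrame u x₀ η ξ g C) (hρ : 0 < ρ) (hρ1 : ρ ≤ 1)
    {c : Plane} (hc : ‖c‖ ≤ 1) (v w : Plane) :
    |fderiv ℝ (fderiv ℝ u) (x₀ + ρ • c) v w| ≤ C * ‖v‖ * ‖w‖ :=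
  ContinuousLinearMap.le_of_opNorm_le _ (ContinuousLinearMap.le_of_opNorm_le _
    (h.bounds.two _ ((norm_add_smul_sub_le hρ hc).trans hρ1)) v) w

theorem abs_fderiv_three_le (h : GradientFrame u x₀ η ξ g C) (hρ : 0 < ρ) (hρ1 : ρ ≤ 1)
    {c : Plane} (hc : ‖c‖ ≤ 1) (v w z : Plane) :
    |fderiv ℝ (fderiv ℝ (fderiv ℝ u)) (x₀ + ρ • c) v w z| ≤ C * ‖v‖ * ‖w‖ * ‖z‖ :=
  ContinuousLinearMap.le_of_opNorm_le _ (ContinuousLinearMap.le_of_opNorm_le _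
    (h.bounds.three _ v ((norm_add_smul_sub_le hρ hc).trans hρ1)) w) z

theorem lower_mul_sub_le_blowUp (h : GradientFrame u x₀ η ξ g C) (hρ : 0 < ρ) (hρ1 : ρ ≤ 1)
    (hε : C * ρ / g ≤ 1 / 100) (x x' y : ℝ) (hx : (x, y) ∈ unitDisc) (hx' : (x', y) ∈ unitDisc)
    (hxx' : x ≤ x') : 99 / 100 * (x' - x) ≤
      blowUp u x₀ η ξ g ρ (x', y) - blowUp u x₀ η ξ g ρ (x, y) := by
  have hg := h.pos
  have hS : {z : ℝ | (z, y) ∈ unitDisc}.OrdConnected := by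
    have : {z : ℝ | (z, y) ∈ unitDisc} = {z | |z| ≤ halfChord y} := by
      ext z
      simp only [unitDisc, mem_ofPred_eq, halfChord]
      constructor
      · intro hz
        exact Real.abs_le_sqrt (by linarith)
      · intro hz
        have h0 : 0 ≤ 1 - y ^ 2 := by
          change x ^ 2 + y ^ 2 ≤ 1 at hx
          nlinarith [sq_nonneg x]
        have := pow_le_pow_left₀ (abs_nonneg z) hz 2
        rw [sq_abs, Real.sq_sqrt h0] at this
        linarith
    rw [this]; exact ordConnected_abs_le _
  have hd : ∀ z ∈ {z : ℝ | (z, y) ∈ unitDisc},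
      HasDerivAt (fun z => blowUp u x₀ η ξ g ρ (z, y))
        (fderiv ℝ u (x₀ + ρ • (z • η + y • ξ)) η / g) z := by
    intro z _
    have e1 : HasDerivAt (fun z : ℝ => x₀ + ρ • (z • η + y • ξ)) (ρ • η) z := by
      simpa using ((((hasDerivAt_id z).smul_const η).add_const (y • ξ)).const_smul ρ).const_add x₀
    have e2 := ((h.contDiff.differentiable (by simp)) _).hasFDerivAt.comp_hasDerivAt z e1
    refine ((e2.sub_const (u x₀)).div_const (ρ * g)).congr_deriv ?_
    rw [map_smul, smul_eq_mul]
    field_simp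
  obtain ⟨ζ, hζ, -, e⟩ := exists_hasDerivAt_sub_eq_mul hS hd hx hx'
  rw [e]
  have h1 := h.abs_fderiv_sub_le hρ hρ1 (h.norm_le_one hζ) η
  rw [h.norm_fst, mul_one, h.fderiv_fst] at h1
  rw [div_le_iff₀ hg] at hε
  have h2 := (abs_le.1 h1).1
  refine mul_le_mul_of_nonneg_right ?_ (by linarith)
  rw [le_div_iff₀ hg]
  linarith

theorem norm_curve_le (h : GradientFrame u x₀ η ξ g C) {t x : ℝ} (ht : |t| ≤ 1)
    (hx : |x| ≤ 1) : ‖curve η ξ t x‖ ≤ 1 := by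
  have := h.norm_le_one (curve_mem_unitDisc ht hx)
  rwa [curve]

theorem hasDerivAt_base {t x : ℝ} (hx : |x| < 1) :
    HasDerivAt (fun x => x₀ + ρ • curve η ξ t x) (ρ • curve1 η ξ t x) x :=
  ((hasDerivAt_curve η ξ t hx).const_smul ρ).const_add x₀

theorem hasDerivAt_fderiv_base (h : GradientFrame u x₀ η ξ g C) {t x : ℝ} (hx : |x| < 1) :
    HasDerivAt (fun x => fderiv ℝ u (x₀ + ρ • curve η ξ t x))
      (fderiv ℝ (fderiv ℝ u) (x₀ + ρ • curve η ξ t x) (ρ • curve1 η ξ t x)) x := by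
  have hD1 : ContDiff ℝ ∞ (fderiv ℝ u) := h.contDiff.fderiv_right (by simp)
  exact ((hD1.differentiable (by simp)) _).hasFDerivAt.comp_hasDerivAt x (hasDerivAt_base hx)

theorem hasDerivAt_fderiv_two_base (h : GradientFrame u x₀ η ξ g C) {t x : ℝ} (hx : |x| < 1) :
    HasDerivAt (fun x => fderiv ℝ (fderiv ℝ u) (x₀ + ρ • curve η ξ t x))
      (fderiv ℝ (fderiv ℝ (fderiv ℝ u)) (x₀ + ρ • curve η ξ t x) (ρ • curve1 η ξ t x)) x := by
  have hD1 : ContDiff ℝ ∞ (fderiv ℝ u) := h.contDiff.fderiv_right (by simp)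
  have hD2 : ContDiff ℝ ∞ (fderiv ℝ (fderiv ℝ u)) := hD1.fderiv_right (by simp)
  exact ((hD2.differentiable (by simp)) _).hasFDerivAt.comp_hasDerivAt x (hasDerivAt_base hx)

theorem hasDerivAt_blowUp_curve (h : GradientFrame u x₀ η ξ g C) (hρ : 0 < ρ) {t x : ℝ}
    (hx : |x| < 1) : HasDerivAt (fun x => blowUp u x₀ η ξ g ρ (x, t * halfChord x))
      (slope1 u x₀ η ξ g ρ t x) x := by
  have hg := h.pos
  have e2 := ((h.contDiff.differentiable (by simp)) _).hasFDerivAt.comp_hasDerivAt x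
    (hasDerivAt_base (x₀ := x₀) (ρ := ρ) (η := η) (ξ := ξ) (t := t) hx)
  refine ((e2.sub_const (u x₀)).div_const (ρ * g)).congr_deriv ?_
  rw [map_smul, smul_eq_mul, slope1]
  field_simp

theorem hasDerivAt_slope1 (h : GradientFrame u x₀ η ξ g C) {t x : ℝ} (hx : |x| < 1) :
    HasDerivAt (slope1 u x₀ η ξ g ρ t) (slope2 u x₀ η ξ g ρ t x) x :=
  ((h.hasDerivAt_fderiv_base hx).clm_apply (hasDerivAt_curve1 η ξ t hx)).div_const g

theorem hasDerivAt_slope2 (h : GradientFrame u x₀ η ξ g C) {t x : ℝ} (hx : |x| < 1) :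
    HasDerivAt (slope2 u x₀ η ξ g ρ t) (slope3 u x₀ η ξ g ρ t x) x := by
  have hs : HasDerivAt (fun x => ρ • curve1 η ξ t x) (ρ • curve2 ξ t x) x :=
    (hasDerivAt_curve1 η ξ t hx).const_smul ρ
  have h1 := (h.hasDerivAt_fderiv_two_base (ρ := ρ) (t := t) hx).clm_apply hs
  have h2 := h1.clm_apply (hasDerivAt_curve1 η ξ t hx)
  have h3 := (h.hasDerivAt_fderiv_base (ρ := ρ) (t := t) hx).clm_apply (hasDerivAt_curve2 ξ t hx)
  refine ((h2.add h3).div_const g).congr_deriv ?_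
  rw [slope3, add_apply]

/-- The velocity differs from `η` by a multiple of `ξ`, which the differential at `x₀` annihilates,
so only the variation of the differential over the disc remains. -/
theorem abs_slope1_sub_one_le (h : GradientFrame u x₀ η ξ g C) (hρ : 0 < ρ) (hρ1 : ρ ≤ 1)
    {t x : ℝ} (ht : |t| ≤ 1) (hx : |x| ≤ 1 / 2) :
    |slope1 u x₀ η ξ g ρ t x - 1| ≤ 24 * C * ρ / g := by
  have hg := h.pos
  have hCρ : 0 ≤ C * ρ := mul_nonneg h.bounds.nonneg hρ.le
  have h1 := h.abs_fderiv_sub_le hρ hρ1 (h.norm_curve_le ht (hx.trans (by norm_num)))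
    (curve1 η ξ t x)
  have e1 : fderiv ℝ u x₀ (curve1 η ξ t x) = g := by
    have := h.fderiv_frame 1 (t * (-x / halfChord x))
    rwa [one_smul, mul_one] at this
  rw [e1] at h1
  have e2 : ∀ A : ℝ, A / g - 1 = (A - g) / g := fun A => by field_simp
  rw [slope1, e2, abs_div, abs_of_pos hg]
  refine div_le_div_of_nonneg_right (h1.trans ?_) hg.le
  have := mul_le_mul_of_nonneg_left (norm_curve1_le h.norm_fst h.norm_snd ht hx) hCρ
  linarith

theorem abs_fderiv_two_curve_le (h : GradientFrame u x₀ η ξ g C) (hρ : 0 < ρ) (hρ1 : ρ ≤ 1)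
    {t x a b : ℝ} (ht : |t| ≤ 1) (hx : |x| ≤ 1) {v w : Plane} (hv : ‖v‖ ≤ a) (hw : ‖w‖ ≤ b) :
    |fderiv ℝ (fderiv ℝ u) (x₀ + ρ • curve η ξ t x) (ρ • v) w| ≤ C * (ρ * a) * b := by
  have hC := h.bounds.nonneg
  have ha := (norm_nonneg _).trans hv
  refine (h.abs_fderiv_two_le hρ hρ1 (h.norm_curve_le ht hx) _ w).trans ?_
  rw [norm_smul, Real.norm_eq_abs, abs_of_pos hρ]
  gcongr

theorem abs_slope2_le (h : GradientFrame u x₀ η ξ g C) (hρ : 0 < ρ) (hρ1 : ρ ≤ 1)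
    {t x : ℝ} (ht : |t| ≤ 1) (hx : |x| ≤ 1 / 2) :
    |slope2 u x₀ η ξ g ρ t x| ≤ 24 * C * ρ / g := by
  have hg := h.pos
  have hCρ : 0 ≤ C * ρ := mul_nonneg h.bounds.nonneg hρ.le
  have hx1 : |x| ≤ 1 := hx.trans (by norm_num)
  have n1 := norm_curve1_le h.norm_fst h.norm_snd ht hx
  rw [slope2, abs_div, abs_of_pos hg]
  refine div_le_div_of_nonneg_right ((abs_add_le _ _).trans ?_) hg.le
  have h1 := h.abs_fderiv_sub_le hρ hρ1 (h.norm_curve_le ht hx1) (curve2 ξ t x)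
  have e1 : fderiv ℝ u x₀ (curve2 ξ t x) = 0 := by rw [curve2, map_smul, h.fderiv_snd, smul_zero]
  rw [e1, sub_zero] at h1
  have h2 := h.abs_fderiv_two_curve_le hρ hρ1 ht hx1 n1 n1
  have h3 := mul_le_mul_of_nonneg_left (norm_curve2_le h.norm_snd ht hx) hCρ
  linarith

/-- The five terms contribute `8 + 4 + 4 + 4 + 4 = 24` times `Cρ`; this is the source of the common
constant 24. -/
theorem abs_slope3_le (h : GradientFrame u x₀ η ξ g C) (hρ : 0 < ρ) (hρ1 : ρ ≤ 1)
    {t x : ℝ} (ht : |t| ≤ 1) (hx : |x| ≤ 1 / 2) :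
    |slope3 u x₀ η ξ g ρ t x| ≤ 24 * C * ρ / g := by
  have hg := h.pos
  have hC := h.bounds.nonneg
  have hCρ : 0 ≤ C * ρ := mul_nonneg hC hρ.le
  have hx1 : |x| ≤ 1 := hx.trans (by norm_num)
  have n1 := norm_curve1_le h.norm_fst h.norm_snd ht hx
  have n2 := norm_curve2_le h.norm_snd ht hx
  have n1ρ : ‖ρ • curve1 η ξ t x‖ ≤ ρ * 2 := by
    rw [norm_smul, Real.norm_eq_abs, abs_of_pos hρ]
    exact mul_le_mul_of_nonneg_left n1 hρ.le
  rw [slope3, abs_div, abs_of_pos hg]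
  refine div_le_div_of_nonneg_right ?_ hg.le
  have h1 := h.abs_fderiv_sub_le hρ hρ1 (h.norm_curve_le ht hx1) (curve3 ξ t x)
  have e1 : fderiv ℝ u x₀ (curve3 ξ t x) = 0 := by rw [curve3, map_smul, h.fderiv_snd, smul_zero]
  rw [e1, sub_zero] at h1
  have h1' := h1.trans (mul_le_mul_of_nonneg_left (norm_curve3_le h.norm_snd ht hx) hCρ)
  have h2 := h.abs_fderiv_two_curve_le hρ hρ1 ht hx1 n1 n2
  have h3 := h.abs_fderiv_two_curve_le hρ hρ1 ht hx1 n2 n1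
  have h4 : |fderiv ℝ (fderiv ℝ (fderiv ℝ u)) (x₀ + ρ • curve η ξ t x) (ρ • curve1 η ξ t x)
        (ρ • curve1 η ξ t x) (curve1 η ξ t x)| ≤ C * (1 * 2) * (ρ * 2) * 2 := by
    refine (h.abs_fderiv_three_le hρ hρ1 (h.norm_curve_le ht hx1) _ _ _).trans ?_
    have a3 : ‖ρ • curve1 η ξ t x‖ ≤ 1 * 2 := n1ρ.trans (by linarith)
    gcongr
  refine (abs_add_le _ _).trans ((add_le_add ((abs_add_le _ _).trans (add_le_add
    ((abs_add_le _ _).trans (add_le_add h4 h3)) h2)) ((abs_add_le _ _).trans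
      (add_le_add h2 h1'))).trans ?_)
  linarith

theorem nearlyLinear_blowUp (h : GradientFrame u x₀ η ξ g C) (hρ : 0 < ρ) (hρ1 : ρ ≤ 1)
    (hε : 24 * C * ρ / g ≤ 1 / 100) {t : ℝ} (ht : |t| ≤ 1) :
    NearlyLinear (fun x => blowUp u x₀ η ξ g ρ (x, t * halfChord x))
      (slope1 u x₀ η ξ g ρ t) (slope2 u x₀ η ξ g ρ t) (slope3 u x₀ η ξ g ρ t)
      (24 * C * ρ / g) where
  small := hε
  abs_sub_le x hx := by
    have hCρ : 0 ≤ C * ρ := mul_nonneg h.bounds.nonneg hρ.le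
    refine (h.abs_blowUp_sub_le hρ hρ1 (curve_mem_unitDisc ht hx)).trans ?_
    exact div_le_div_of_nonneg_right (by linarith) h.pos.le
  deriv_zero x hx := h.hasDerivAt_blowUp_curve hρ (by linarith)
  deriv_one x hx := h.hasDerivAt_slope1 (by linarith)
  deriv_two x hx := h.hasDerivAt_slope2 (by linarith)
  bound_one x hx := h.abs_slope1_sub_one_le hρ hρ1 ht hx
  bound_two x hx := h.abs_slope2_le hρ hρ1 ht hx
  bound_three x hx := h.abs_slope3_le hρ hρ1 ht hx

end GradientFrame

/-! ### First-order expansions and the centre of the mode -/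

namespace GradientFrame

variable {u : Plane → ℝ} {x₀ η ξ : Plane} {g C ρ : ℝ}

theorem abs_blowUp_zero_sub_le (h : GradientFrame u x₀ η ξ g C) (hρ : 0 < ρ) (hρ1 : ρ ≤ 1)
    {t : ℝ} (ht : |t| ≤ 1) :
    |blowUp u x₀ η ξ g ρ (0, t * halfChord 0) -
      ρ * t ^ 2 * fderiv ℝ (fderiv ℝ u) x₀ ξ ξ / (2 * g)| ≤ C * ρ ^ 2 / g := by
  have hg := h.pos
  have h0 : halfChord 0 = 1 := by simp [halfChord]
  have hρt : |ρ * t| ≤ ρ := by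
    rw [abs_mul, abs_of_pos hρ]; exact mul_le_of_le_one_right hρ.le ht
  have h1 := h.bounds.abs_sub_sub_sq_le h.contDiff h.norm_snd h.fderiv_snd (hρt.trans hρ1)
  have e : blowUp u x₀ η ξ g ρ (0, t * halfChord 0) -
      ρ * t ^ 2 * fderiv ℝ (fderiv ℝ u) x₀ ξ ξ / (2 * g) =
      (u (x₀ + (ρ * t) • ξ) - u x₀ - (ρ * t) ^ 2 / 2 * fderiv ℝ (fderiv ℝ u) x₀ ξ ξ) /
        (ρ * g) := by
    rw [blowUp, h0]
    simp only [zero_smul, zero_add, mul_one, smul_smul]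
    field_simp
  rw [e, abs_div, abs_of_pos (mul_pos hρ hg), div_le_div_iff₀ (mul_pos hρ hg) hg]
  have h2 := pow_le_pow_left₀ (abs_nonneg _) hρt 3
  calc _ ≤ C * ρ ^ 3 * g := mul_le_mul_of_nonneg_right
        (h1.trans (mul_le_mul_of_nonneg_left h2 h.bounds.nonneg)) hg.le
    _ = C * ρ ^ 2 * (ρ * g) := by ring

theorem abs_fderiv_two_base_le (h : GradientFrame u x₀ η ξ g C) (v w : Plane) :
    |fderiv ℝ (fderiv ℝ u) x₀ v w| ≤ C * ‖v‖ * ‖w‖ :=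
  ContinuousLinearMap.le_of_opNorm_le _ (ContinuousLinearMap.le_of_opNorm_le _
    (h.bounds.two x₀ (by simp)) v) w

theorem abs_fderiv_snd_sub_le (h : GradientFrame u x₀ η ξ g C) (hρ : 0 < ρ) (hρ1 : ρ ≤ 1)
    {t x : ℝ} (ht : |t| ≤ 1) (hx : |x| ≤ 1) :
    |fderiv ℝ u (x₀ + ρ • curve η ξ t x) ξ - ρ * t * fderiv ℝ (fderiv ℝ u) x₀ ξ ξ| ≤
      C * ρ ^ 2 + 2 * C * ρ * |x| := by
  have hC := h.bounds.nonneg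
  have hc := h.norm_curve_le ht hx
  have hk := norm_add_smul_sub_le (x₀ := x₀) hρ hc
  have h1 := (h.bounds.one_sub_sub _ (hk.trans hρ1)).trans
    (mul_le_mul_of_nonneg_left (pow_le_pow_left₀ (norm_nonneg _) hk 2) hC)
  have h2 := ContinuousLinearMap.le_of_opNorm_le _ h1 ξ
  rw [add_sub_cancel_left, sub_apply, sub_apply, h.fderiv_snd, h.norm_snd, mul_one, sub_zero,
    Real.norm_eq_abs, map_smul, smul_apply, smul_eq_mul] at h2
  have hct : ‖curve η ξ t x - t • ξ‖ ≤ 2 * |x| := by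
    have e : curve η ξ t x - t • ξ = x • η + (t * (halfChord x - 1)) • ξ := by
      rw [curve]; module
    have h3 : |halfChord x - 1| ≤ |x| := by
      rw [abs_of_nonpos (by linarith [halfChord_le_one x])]
      have := one_sub_sq_le_halfChord hx
      rw [← sq_abs] at this
      nlinarith [abs_nonneg x]
    rw [e]
    refine (norm_add_le _ _).trans ?_
    rw [norm_smul, norm_smul, h.norm_fst, h.norm_snd, Real.norm_eq_abs, Real.norm_eq_abs, abs_mul]
    have := mul_le_of_le_one_left (abs_nonneg (halfChord x - 1)) ht
    linarith
  have h3 := h.abs_fderiv_two_base_le (curve η ξ t x - t • ξ) ξ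
  rw [h.norm_snd, mul_one, map_sub, sub_apply, map_smul, smul_apply, smul_eq_mul] at h3
  have h4 := h3.trans (mul_le_mul_of_nonneg_left hct hC)
  have e : fderiv ℝ u (x₀ + ρ • curve η ξ t x) ξ - ρ * t * fderiv ℝ (fderiv ℝ u) x₀ ξ ξ =
      (fderiv ℝ u (x₀ + ρ • curve η ξ t x) ξ -
        ρ * fderiv ℝ (fderiv ℝ u) x₀ (curve η ξ t x) ξ) +
      ρ * (fderiv ℝ (fderiv ℝ u) x₀ (curve η ξ t x) ξ -
        t * fderiv ℝ (fderiv ℝ u) x₀ ξ ξ) := by ring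
  rw [e]
  refine (abs_add_le _ _).trans ?_
  rw [abs_mul ρ, abs_of_pos hρ]
  have := mul_le_mul_of_nonneg_left h4 hρ.le
  linarith

theorem abs_fderiv_two_fst_sub_le (h : GradientFrame u x₀ η ξ g C) (hρ : 0 < ρ) (hρ1 : ρ ≤ 1)
    {t x : ℝ} (ht : |t| ≤ 1) (hx : |x| ≤ 1 / 2) :
    |fderiv ℝ (fderiv ℝ u) (x₀ + ρ • curve η ξ t x) (curve1 η ξ t x) (curve1 η ξ t x) -
      fderiv ℝ (fderiv ℝ u) x₀ η η| ≤ 4 * C * ρ + 6 * C * |x| := by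
  have hC := h.bounds.nonneg
  have hk := norm_add_smul_sub_le (x₀ := x₀) hρ
    (h.norm_curve_le (x := x) ht (hx.trans (by norm_num)))
  have n1 := norm_curve1_le h.norm_fst h.norm_snd ht hx
  have n1' := norm_curve1_sub_le (η := η) h.norm_snd ht hx
  set c := curve1 η ξ t x
  have h1 := (h.bounds.two_sub _ (hk.trans hρ1)).trans (mul_le_mul_of_nonneg_left hk hC)
  have h2 : |fderiv ℝ (fderiv ℝ u) (x₀ + ρ • curve η ξ t x) c c -
      fderiv ℝ (fderiv ℝ u) x₀ c c| ≤ C * ρ * 2 * 2 := by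
    have := ContinuousLinearMap.le_of_opNorm_le _ (ContinuousLinearMap.le_of_opNorm_le _ h1 c) c
    rw [sub_apply, sub_apply, Real.norm_eq_abs] at this
    refine this.trans ?_
    gcongr
  have h3 : |fderiv ℝ (fderiv ℝ u) x₀ (c - η) c| ≤ C * (2 * |x|) * 2 := by
    refine (h.abs_fderiv_two_base_le _ _).trans ?_
    gcongr
  have h4 : |fderiv ℝ (fderiv ℝ u) x₀ η (c - η)| ≤ C * 1 * (2 * |x|) := by
    refine (h.abs_fderiv_two_base_le _ _).trans ?_
    rw [h.norm_fst]
    gcongr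
  rw [map_sub, sub_apply] at h3
  rw [map_sub] at h4
  have e : fderiv ℝ (fderiv ℝ u) (x₀ + ρ • curve η ξ t x) c c - fderiv ℝ (fderiv ℝ u) x₀ η η =
      (fderiv ℝ (fderiv ℝ u) (x₀ + ρ • curve η ξ t x) c c - fderiv ℝ (fderiv ℝ u) x₀ c c) +
      (fderiv ℝ (fderiv ℝ u) x₀ c c - fderiv ℝ (fderiv ℝ u) x₀ η c) +
      (fderiv ℝ (fderiv ℝ u) x₀ η c - fderiv ℝ (fderiv ℝ u) x₀ η η) := by ring
  rw [e]
  refine (abs_add_le _ _).trans ((add_le_add_left (abs_add_le _ _) _).trans ?_)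
  linarith

/-- The velocity is nearly `η`, giving `ρ u_ηη`. The acceleration is nearly `-tξ` and the derivative
of `u` along `ξ` nearly `ρ t u_ξξ`, giving `-ρ t² u_ξξ`. -/
theorem abs_slope2_sub_le (h : GradientFrame u x₀ η ξ g C) (hρ : 0 < ρ) (hρ1 : ρ ≤ 1)
    {t x : ℝ} (ht : |t| ≤ 1) (hx : |x| ≤ 1 / 2) :
    |slope2 u x₀ η ξ g ρ t x - ρ * (fderiv ℝ (fderiv ℝ u) x₀ η η -
      t ^ 2 * fderiv ℝ (fderiv ℝ u) x₀ ξ ξ) / g| ≤ (6 * C * ρ ^ 2 + 13 * C * ρ * |x|) / g := by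
  have hg := h.pos
  have hC := h.bounds.nonneg
  have h1 := h.abs_fderiv_two_fst_sub_le hρ hρ1 ht hx
  have h2 := h.abs_fderiv_snd_sub_le hρ hρ1 ht (hx.trans (by norm_num))
  have hβ := abs_one_div_halfChord_cube_le hx
  have hβ1 := abs_one_div_halfChord_cube_add_one_le hx
  have hd := h.abs_fderiv_two_base_le ξ ξ
  rw [h.norm_snd, mul_one, mul_one] at hd
  rw [slope2, curve2, map_smul, map_smul, smul_apply, smul_eq_mul, smul_eq_mul]
  generalize -1 / halfChord x ^ 3 = β at *
  generalize fderiv ℝ (fderiv ℝ u) (x₀ + ρ • curve η ξ t x) (curve1 η ξ t x) (curve1 η ξ t x) = A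
    at *
  generalize fderiv ℝ u (x₀ + ρ • curve η ξ t x) ξ = B at *
  generalize fderiv ℝ (fderiv ℝ u) x₀ η η = a at *
  generalize fderiv ℝ (fderiv ℝ u) x₀ ξ ξ = d at *
  rw [← sub_div, abs_div, abs_of_pos hg]
  refine div_le_div_of_nonneg_right ?_ hg.le
  have e : ρ * A + t * β * B - ρ * (a - t ^ 2 * d) =
      ρ * (A - a) + t * (β * (B - ρ * t * d)) + t ^ 2 * (ρ * ((β + 1) * d)) := by ring
  have b1 : |ρ * (A - a)| ≤ ρ * (4 * C * ρ + 6 * C * |x|) := by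
    rw [abs_mul, abs_of_pos hρ]; gcongr
  have b2 : |t * (β * (B - ρ * t * d))| ≤ 1 * (2 * (C * ρ ^ 2 + 2 * C * ρ * |x|)) := by
    rw [abs_mul, abs_mul]; gcongr
  have b3 : |t ^ 2 * (ρ * ((β + 1) * d))| ≤ 1 * (ρ * (3 * |x| * C)) := by
    rw [abs_mul, abs_mul, abs_mul, abs_of_pos hρ, abs_pow]
    have : |t| ^ 2 ≤ 1 := pow_le_one₀ (abs_nonneg t) ht
    gcongr
  rw [e]
  refine (abs_add_le _ _).trans ((add_le_add ((abs_add_le _ _).trans (add_le_add b1 b2)) b3).trans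
    ?_)
  linarith

/-- The mean of `t²` over `[-1, 1]` is 1/3, which singles out this value of `c`. -/
theorem integral_centering_eq_zero (c a d : ℝ) (hc : c = (d - 2 * a) / (2 * g)) (hg : 0 < g) :
    ∫ t in Icc (-1 : ℝ) 1, ρ * (c + a / g - 3 * d / (2 * g) * t ^ 2) = 0 := by
  rw [integral_Icc_eq_integral_Ioc, ← intervalIntegral.integral_of_le (by norm_num),
    intervalIntegral.integral_const_mul, intervalIntegral.integral_sub (by simp)
      (Continuous.intervalIntegrable (by fun_prop) _ _),
    intervalIntegral.integral_const_mul, integral_pow, intervalIntegral.integral_const, hc]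
  simp only [smul_eq_mul]
  field_simp
  norm_num
  ring_nf
  simp

/-- In the blown-up picture the mode is unique and lies near `c ρ`. -/
theorem exists_mode_blowUp (h : GradientFrame u x₀ η ξ g C) {c : ℝ}
    (hc : c = (fderiv ℝ (fderiv ℝ u) x₀ ξ ξ - 2 * fderiv ℝ (fderiv ℝ u) x₀ η η) / (2 * g)) :
    ∃ K, ∀ᶠ ρ : ℝ in 𝓝[>] 0, ∃ m,
      (∀ z, IsModeOf (discDistribution (blowUp u x₀ η ξ g ρ)) z ↔ z = m) ∧
        |m - c * ρ| ≤ K * ρ ^ 2 := by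
  have hg := h.pos
  have hC := h.bounds.nonneg
  -- Chosen so that the permitted abscissae satisfy `|x| ≤ Lρ`; this makes the error terms `ρ|x|`
  -- quadratic in `ρ`.
  set L : ℝ := 2 * (|c| + 24 * C / g) with hL
  refine ⟨4 * (20 * (|c| + 24 * C / g) ^ 2 + (7 * C + 13 * C * L) / g), ?_⟩
  have ev0 : ∀ᶠ ρ : ℝ in 𝓝[>] 0, 0 < ρ := self_mem_nhdsWithin
  have ev : ∀ (A B : ℝ), 0 < B → ∀ᶠ ρ : ℝ in 𝓝[>] 0, A * ρ < B := by
    intro A B hB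
    have : Tendsto (fun ρ : ℝ => A * ρ) (𝓝[>] 0) (𝓝 (A * 0)) :=
      ((continuous_const_mul A).tendsto 0).mono_left nhdsWithin_le_nhds
    rw [mul_zero] at this
    exact this.eventually (gt_mem_nhds hB)
  filter_upwards [ev0, ev 1 1 one_pos, ev (24 * C / g) (1 / 100) (by norm_num),
    ev |c| (2 / 5) (by norm_num)] with ρ hρ hρ1 hε hs
  rw [one_mul] at hρ1
  rw [div_mul_eq_mul_div] at hε
  have hs0 : |c * ρ| = |c| * ρ := by rw [abs_mul, abs_of_pos hρ]
  have hε' : C * ρ / g ≤ 24 * C * ρ / g :=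
    div_le_div_of_nonneg_right (by nlinarith) hg.le
  have hV : Continuous (blowUp u x₀ η ξ g ρ) := by
    have := h.contDiff.continuous
    unfold blowUp; fun_prop
  have hη : ∀ t : ℝ, |t| ≤ 1 → ∀ x : ℝ, |x| ≤ 1 / 2 → |x| ≤ 2 * (|c * ρ| + 24 * C * ρ / g) →
      |(c * ρ - blowUp u x₀ η ξ g ρ (0, t * halfChord 0)) + slope2 u x₀ η ξ g ρ t x -
        ρ * (c + fderiv ℝ (fderiv ℝ u) x₀ η η / g -
          3 * fderiv ℝ (fderiv ℝ u) x₀ ξ ξ / (2 * g) * t ^ 2)| ≤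
        (7 * C + 13 * C * L) / g * ρ ^ 2 := by
    intro t ht x hx hx'
    have h1 := h.abs_blowUp_zero_sub_le hρ hρ1.le ht
    have h2 := h.abs_slope2_sub_le hρ hρ1.le ht hx
    have hx2 : |x| ≤ L * ρ := by
      refine hx'.trans (le_of_eq ?_)
      rw [hs0, hL]; ring
    generalize fderiv ℝ (fderiv ℝ u) x₀ η η = a at *
    generalize fderiv ℝ (fderiv ℝ u) x₀ ξ ξ = d at *
    have e : c * ρ - blowUp u x₀ η ξ g ρ (0, t * halfChord 0) + slope2 u x₀ η ξ g ρ t x -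
        ρ * (c + a / g - 3 * d / (2 * g) * t ^ 2) =
        (slope2 u x₀ η ξ g ρ t x - ρ * (a - t ^ 2 * d) / g) -
          (blowUp u x₀ η ξ g ρ (0, t * halfChord 0) - ρ * t ^ 2 * d / (2 * g)) := by
      field_simp; ring
    rw [e]
    refine (abs_sub _ _).trans ((add_le_add h2 h1).trans ?_)
    rw [← add_div, div_mul_eq_mul_div]
    refine div_le_div_of_nonneg_right ?_ hg.le
    have := mul_le_mul_of_nonneg_left hx2 (by positivity : 0 ≤ 13 * C * ρ)
    linarith
  obtain ⟨m, hm, hm'⟩ := existsUnique_isModeOf_discDistribution hV (s₀ := c * ρ)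
    (ε := 24 * C * ρ / g) (η := (7 * C + 13 * C * L) / g * ρ ^ 2)
    (l := fun t => ρ * (c + fderiv ℝ (fderiv ℝ u) x₀ η η / g -
      3 * fderiv ℝ (fderiv ℝ u) x₀ ξ ξ / (2 * g) * t ^ 2))
    (fun p hp => (h.abs_blowUp_sub_le hρ hρ1.le hp).trans (by linarith))
    (fun x x' y => h.lower_mul_sub_le_blowUp hρ hρ1.le (by linarith) x x' y)
    (fun t ht => h.nearlyLinear_blowUp hρ hρ1.le hε.le ht)
    (by rw [hs0]; exact hs) (by fun_prop) (integral_centering_eq_zero c _ _ hc hg) hη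
  refine ⟨m, hm, hm'.trans (le_of_eq ?_)⟩
  rw [hs0]
  field_simp

end GradientFrame

/-! ### Regular points of the image -/

theorem gradientFrame_of_gradient_ne_zero {u : Plane → ℝ} (hu : ContDiff ℝ ∞ u) {x₀ : Plane}
    (hg : gradient u x₀ ≠ 0) :
    ∃ C, GradientFrame u x₀ (gradDir u x₀) (levelDir u x₀) ‖gradient u x₀‖ C := by
  obtain ⟨C, hC⟩ := exists_taylorBounds hu x₀
  have hpos : 0 < ‖gradient u x₀‖ := norm_pos_iff.2 hg
  have hη : ‖gradDir u x₀‖ = 1 := by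
    rw [gradDir, norm_smul, norm_inv, norm_norm, inv_mul_cancel₀ hpos.ne']
  have hd : ∀ v, fderiv ℝ u x₀ v = inner ℝ (gradient u x₀) v := fun v => by
    rw [inner_gradient_left]
  have hgη : gradient u x₀ = ‖gradient u x₀‖ • gradDir u x₀ := by
    rw [gradDir, smul_smul, mul_inv_cancel₀ hpos.ne', one_smul]
  have hinner : inner ℝ (gradDir u x₀) (levelDir u x₀) = 0 := by
    simp [levelDir, PiLp.inner_apply, Fin.sum_univ_two]
    ring
  have hξ : ‖levelDir u x₀‖ = 1 := by
    rw [← hη, EuclideanSpace.norm_eq, EuclideanSpace.norm_eq]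
    simp [levelDir, Fin.sum_univ_two, add_comm]
  refine ⟨C, hu, hη, hξ, hinner, hpos, ?_, ?_, hC⟩
  · rw [hd, hgη, inner_smul_left, real_inner_self_eq_norm_sq, norm_smul, hη]
    simp
  · rw [hd, hgη, inner_smul_left, hinner, mul_zero]

theorem secondDirDeriv_eq (u : Plane → ℝ) (x v : Plane) :
    secondDirDeriv u x v = fderiv ℝ (fderiv ℝ u) x v v := by
  rw [secondDirDeriv, iteratedFDeriv_two_apply]
  rfl

/-- Undoing the blow-up multiplies the error `Kρ²` by `ρg` and turns `cρ` into `ρ²/2` times the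
right-hand side of the mode equation. -/
theorem exists_isDiscMode_near_explicitStep {u : Plane → ℝ} (hu : ContDiff ℝ ∞ u) {x₀ : Plane}
    (hg : gradient u x₀ ≠ 0) :
    ∃ C : ℝ, ∀ᶠ ρ : ℝ in 𝓝[>] 0, ∃ m : ℝ,
      (∀ z : ℝ, IsDiscMode u x₀ ρ z ↔ z = m) ∧
      |m - explicitStep modeFlow (ρ ^ 2 / 2) u x₀| ≤ C * ρ ^ 3 := by
  obtain ⟨C, h⟩ := gradientFrame_of_gradient_ne_zero hu hg
  set η := gradDir u x₀ with hη
  set ξ := levelDir u x₀ with hξ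
  set g := ‖gradient u x₀‖
  obtain ⟨K, hK⟩ := h.exists_mode_blowUp rfl
  refine ⟨g * K, ?_⟩
  have ev0 : ∀ᶠ ρ : ℝ in 𝓝[>] 0, 0 < ρ := self_mem_nhdsWithin
  filter_upwards [hK, ev0] with ρ ⟨m, hm, hm'⟩ hρ
  have hρg : 0 < ρ * g := mul_pos hρ h.pos
  have haff : ∀ z, IsDiscMode u x₀ ρ (u x₀ + ρ * g * z) ↔ z = m := fun z => by
    rw [← hm z]
    exact isModeOf_affine hρg (by simpa using hρ.ne') ENNReal.ofReal_ne_top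
      (valueDistribution_Icc_eq h.contDiff.continuous h.norm_fst h.norm_snd h.inner_eq x₀ hρ h.pos)
  refine ⟨u x₀ + ρ * g * m, fun z => ?_, ?_⟩
  · have hz : z = u x₀ + ρ * g * ((z - u x₀) / (ρ * g)) := by
      rw [mul_div_cancel₀ _ hρg.ne']; ring
    rw [hz, haff, add_right_inj, mul_right_inj' hρg.ne']
  · have hg0 := h.pos.ne'
    have e : u x₀ + ρ * g * m - explicitStep modeFlow (ρ ^ 2 / 2) u x₀ = ρ * g * (m -
        (fderiv ℝ (fderiv ℝ u) x₀ ξ ξ - 2 * fderiv ℝ (fderiv ℝ u) x₀ η η) / (2 * g) * ρ) := by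
      rw [explicitStep, modeFlow, uXiXi, uEtaEta, secondDirDeriv_eq, secondDirDeriv_eq, ← hη, ← hξ]
      field_simp
      ring
    rw [e, abs_mul, abs_of_pos hρg]
    calc _ ≤ ρ * g * (K * ρ ^ 2) := mul_le_mul_of_nonneg_left hm' hρg.le
      _ = g * K * ρ ^ 3 := by ring

/-! ### Local extrema -/

theorem valueDistribution_eq_zero_of_forall_notMem {u : Plane → ℝ} (hu : Continuous u)
    {x₀ : Plane} {ρ : ℝ} {s : Set ℝ} (hs : MeasurableSet s)
    (h : ∀ p ∈ Metric.closedBall x₀ ρ, u p ∉ s) : valueDistribution u x₀ ρ s = 0 := by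
  rw [valueDistribution, Measure.map_apply hu.measurable hs,
    Measure.restrict_apply (hu.measurable hs)]
  convert measure_empty (μ := (volume : Measure Plane))
  ext p
  simp only [mem_inter_iff, mem_preimage, mem_empty_iff_false, iff_false, not_and]
  exact fun h1 h2 => h p h2 h1

instance isFiniteMeasure_valueDistribution (u : Plane → ℝ) (x₀ : Plane) (ρ : ℝ) :
    IsFiniteMeasure (valueDistribution u x₀ ρ) := by
  have : IsFiniteMeasure ((volume : Measure Plane).restrict (Metric.closedBall x₀ ρ)) :=
    ⟨by simpa using (isCompact_closedBall x₀ ρ).measure_lt_top (μ := volume)⟩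
  unfold valueDistribution; infer_instance

/-- Outside the closed set the density is zero, whereas at a mode it is positive because the disc
has positive area. At an extremum the set is a half-line. -/
theorem exists_isDiscMode_and_forall_mem {u : Plane → ℝ} (hu : Continuous u) {x₀ : Plane} {ρ : ℝ}
    (hρ : 0 < ρ) {s : Set ℝ} (hs : IsClosed s) (h : ∀ p ∈ Metric.closedBall x₀ ρ, u p ∈ s) :
    (∃ m, IsDiscMode u x₀ ρ m) ∧ ∀ m, IsDiscMode u x₀ ρ m → m ∈ s := by
  obtain ⟨R, hR⟩ := (isCompact_closedBall x₀ ρ).exists_bound_of_continuousOn hu.continuousOn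
  have h0 : valueDistribution u x₀ ρ (Icc (-R) R)ᶜ = 0 :=
    valueDistribution_eq_zero_of_forall_notMem hu measurableSet_Icc.compl
      fun p hp hn => hn (abs_le.1 (hR p hp))
  have hR0 : 0 ≤ R := (norm_nonneg _).trans (hR x₀ (Metric.mem_closedBall_self hρ.le))
  refine ⟨(exists_isModeOf (by linarith) h0).imp fun m hm => hm.2, fun m hm => ?_⟩
  by_contra hms
  refine IsModeOf.densityAt_ne_zero h0 (fun hz => ?_) hm
    (densityAt_eq_zero_of_null (hs.isOpen_compl.mem_nhds hms)
      (valueDistribution_eq_zero_of_forall_notMem hu hs.measurableSet.compl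
        fun p hp hn => hn (h p hp)))
  have h1 : valueDistribution u x₀ ρ univ = 0 := by rw [hz]; rfl
  rw [valueDistribution, Measure.map_apply hu.measurable MeasurableSet.univ, preimage_univ,
    Measure.restrict_apply_univ] at h1
  exact (Metric.measure_closedBall_pos volume x₀ hρ).ne' h1

theorem eventually_forall_mem_closedBall {X : Type*} [PseudoMetricSpace X] {x₀ : X} {p : X → Prop}
    (h : ∀ᶠ x in 𝓝 x₀, p x) : ∀ᶠ ρ : ℝ in 𝓝[>] 0, 0 < ρ ∧ ∀ x ∈ Metric.closedBall x₀ ρ, p x := by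
  obtain ⟨δ, hδ, H⟩ := Metric.eventually_nhds_iff_ball.1 h
  filter_upwards [Ioo_mem_nhdsGT hδ] with ρ hρ
  exact ⟨hρ.1, fun x hx => H x (Metric.closedBall_subset_ball hρ.2 hx)⟩

theorem mainTheorem2 (u : Plane → ℝ) (hu : ContDiff ℝ ∞ u) (x₀ : Plane) :
    (gradient u x₀ ≠ 0 →
      (∃ C : ℝ, ∀ᶠ ρ : ℝ in 𝓝[>] 0, ∃ m : ℝ,
        (∀ z : ℝ, IsDiscMode u x₀ ρ z ↔ z = m) ∧
        |m - explicitStep modeFlow (ρ ^ 2 / 2) u x₀| ≤ C * ρ ^ 3) ∧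
      Tendsto (fun p : ℝ => orderPFlow p u x₀) (𝓝[>] (-1)) (𝓝 (modeFlow u x₀)) ∧
      (∀ ρ : ℝ, Tendsto (fun p : ℝ => ρ ^ 2 / (2 * p + 4)) (𝓝[>] (-1)) (𝓝 (ρ ^ 2 / 2)))) ∧
    (IsLocalMin u x₀ →
      ∀ᶠ ρ : ℝ in 𝓝[>] 0,
        (∃ m : ℝ, IsDiscMode u x₀ ρ m) ∧
        ∀ m : ℝ, IsDiscMode u x₀ ρ m → 0 ≤ m - u x₀) ∧
    (IsLocalMax u x₀ →
      ∀ᶠ ρ : ℝ in 𝓝[>] 0,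
        (∃ m : ℝ, IsDiscMode u x₀ ρ m) ∧
        ∀ m : ℝ, IsDiscMode u x₀ ρ m → m - u x₀ ≤ 0) := by
  refine ⟨fun hg => ⟨exists_isDiscMode_near_explicitStep hu hg, ?_, fun ρ => ?_⟩, fun hmin => ?_,
    fun hmax => ?_⟩
  · have h1 : Continuous fun p : ℝ => orderPFlow p u x₀ := by unfold orderPFlow; fun_prop
    have h2 := (h1.tendsto (-1)).mono_left (nhdsWithin_le_nhds (s := Ioi (-1)))
    convert h2 using 2
    rw [modeFlow, orderPFlow]; ring
  · have h1 : ContinuousAt (fun p : ℝ => ρ ^ 2 / (2 * p + 4)) (-1) :=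
      ContinuousAt.div (by fun_prop) (by fun_prop) (by norm_num)
    have h2 := h1.tendsto.mono_left (nhdsWithin_le_nhds (s := Ioi (-1)))
    convert h2 using 2
    norm_num
  · filter_upwards [eventually_forall_mem_closedBall hmin] with ρ hρ
    have := exists_isDiscMode_and_forall_mem hu.continuous hρ.1 isClosed_Ici hρ.2
    exact ⟨this.1, fun m hm => sub_nonneg.2 (this.2 m hm)⟩
  · filter_upwards [eventually_forall_mem_closedBall hmax] with ρ hρ
    have := exists_isDiscMode_and_forall_mem hu.continuous hρ.1 isClosed_Iic hρ.2
    exact ⟨this.1, fun m hm => sub_nonpos.2 (this.2 m hm)⟩
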